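/- Let $s\in\mathbb N$, $[s]=\{1,\dots,s\}$, and let $[\boldsymbol a,\boldsymbol b]=\prod_{j=1}^s[a_j,b_j]$ with $-\infty<a_j<b_j<\infty$. For each $j\in[s]$ and $k\in\{0,\dots,n_j\}$ let $\varphi_{j,k}:[a_j,b_j]\to[0,\infty)$ be a probability density whose distribution function $\Phi_{j,k}(x)=\int_{a_j}^x\varphi_{j,k}(y)\,\mathrm dy$ is a bijection from $[a_j,b_j]$ to $[0,1]$. Let $\mathcal N=\prod_{j=1}^s\{0,\dots,n_j\}$, let $c_{\boldsymbol k}\ge 0$ for $\boldsymbol k\in\mathcal N$ with $c=\sum_{\boldsymbol k\in\mathcal N}c_{\boldsymbol k}>0$, and let $$\overline\varphi(\boldsymbol x)=\frac1c\sum_{\boldsymbol k\in\mathcal N}c_{\boldsymbol k}\prod_{j=1}^s\varphi_{j,k_j}(x_j),\qquad \Phi_{\boldsymbol k}^{-1}(\boldsymbol y)=\bigl(\Phi_{1,k_1}^{-1}(y_1),\dots,\Phi_{s,k_s}^{-1}(y_s)\bigr).$$ Let $N\ge 2$ be an integer and $\delta\in(0,N)$. Order $\mathcal N$ as $\boldsymbol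 k_1,\boldsymbol k_2,\dots$ with $c_{\boldsymbol k_1}\ge c_{\boldsymbol k_2}\ge\cdots$ (ties in any order), let $r=r(\delta,N)$ be the smallest number with $\sum_{v=1}^r c_{\boldsymbol k_v}/c\ge 1-\delta/N$, and put $N_{\boldsymbol k_v}=\lfloor Nc_{\boldsymbol k_v}/c\rfloor$ for $v<r$ and $N_{\boldsymbol k_r}=N-\sum_{v<r}N_{\boldsymbol k_v}$. Let $(\boldsymbol y_n)_{n\ge0}$ be a digital $(t,s)$-sequence over $\mathbb F_2$ with non-singular upper triangular generating matrices $C_1,\dots,C_s\in\mathbb F_2^{\mathbb N\times\mathbb N}$; that is, for all $m\ge t$ and all integers $d_1,\dots,d_s\ge0$ with $d_1+\dots+d_s=m-t$, the first $d_j$ rows of the upper left $m\times m$ submatrices of $C_j$, $j\in[s]$, form together a linearly independent system, and the $j$-th coordinate of $\boldsymbol y_n$ is $\sum_{i\ge1}\eta_i2^{-i}$, where $(\eta_1,\eta_2,\dots)^\top\in\mathbb F_2^{\mathbb N}$ is the product of $C_j$ with the vector of binary digits of $n$ (least significant digit first). Define $$\mathcal A_{N,s}(f)=\frac1c\sum_{v=1}^r\frac{c_{\boldsymbol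 k_v}}{N_{\boldsymbol k_v}}\sum_{n=0}^{N_{\boldsymbol k_v}-1}f\bigl(\Phi_{\boldsymbol k_v}^{-1}(\boldsymbol y_n)\bigr),$$ where a term with $N_{\boldsymbol k_v}=0$ is read as $0$. Let $1\le p,q\le\infty$ with $1/p+1/q=1$, let $\gamma_{\mathfrak u}>0$ for $\mathfrak u\subseteq[s]$ with $\gamma_\emptyset\le 1$, and let $$\|f\|_{p,s,\boldsymbol\gamma}=\Bigl(\sum_{\mathfrak u\subseteq[s]}\Bigl(\frac1{\gamma_{\mathfrak u}}\sup_{\boldsymbol x\in[\boldsymbol a,\boldsymbol b]}\Bigl|\frac{\partial^{|\mathfrak u|}f}{\partial\boldsymbol x_{\mathfrak u}}(\boldsymbol x)\Bigr|\Bigr)^p\Bigr)^{1/p},$$ $$G_{\boldsymbol\gamma,q,\boldsymbol a,\boldsymbol b}(N)=\Bigl(\sum_{\emptyset\ne\mathfrak u\subseteq[s]}\Bigl(\gamma_{\mathfrak u}\prod_{j\in\mathfrak u}(3(b_j-a_j)\log N)\Bigr)^q\Bigr)^{1/q},$$ with maxima in place of the sums if $p=\infty$ or $q=\infty$. Then $r\le\prod_{j=1}^s(n_j+1)$,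 and for every $f:[\boldsymbol a,\boldsymbol b]\to\mathbb R$ whose mixed partial derivatives of order at most one in each variable exist and for which $\|f\|_{p,s,\boldsymbol\gamma}<\infty$, the function $f\overline\varphi$ is integrable on $[\boldsymbol a,\boldsymbol b]$ and $$\left|\int_{[\boldsymbol a,\boldsymbol b]}f(\boldsymbol x)\overline\varphi(\boldsymbol x)\,\mathrm d\boldsymbol x-\mathcal A_{N,s}(f)\right|\le\|f\|_{p,s,\boldsymbol\gamma}\,\frac{\delta+3r-2}{N}\,\bigl[1+5\cdot2^t\log(2N)\,G_{\boldsymbol\gamma,q,\boldsymbol a,\boldsymbol b}(N)\bigr].$$ -/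

import Mathlib

open scoped ENNReal

namespace MixtureQMC

noncomputable section

/-! ### Integrands on a box and the weighted norm -/

/-- The first order partial derivative of `g` in direction `j` on the box `[a, b]`
(one-sided on the faces of the box). -/
def partialDeriv {s : ℕ} (a b : Fin s → ℝ) (j : Fin s) (g : (Fin s → ℝ) → ℝ) :
    (Fin s → ℝ) → ℝ :=
  fun x => derivWithin (fun y => g (Function.update x j y)) (Set.Icc (a j) (b j)) (x j)

/-- The mixed partial derivative `∂_{u₁} (∂_{u₂} (⋯ (∂_{uₖ} f)))` on the box `[a, b]`, where
`u = {u₁ < u₂ < ⋯ < uₖ}`; for `u = ∅` it is `f`. -/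
def mixedPartial {s : ℕ} (a b : Fin s → ℝ) (u : Finset (Fin s)) (f : (Fin s → ℝ) → ℝ) :
    (Fin s → ℝ) → ℝ :=
  (u.sort (· ≤ ·)).foldr (fun j g => partialDeriv a b j g) f

/-- All mixed partial derivatives of `f` of order at most one in each variable exist at every
point of the box `[a, b]`: if `j < min u`, then the derivative indexed by `u` is differentiable
in the variable `j`. -/
def HasMixedPartials {s : ℕ} (a b : Fin s → ℝ) (f : (Fin s → ℝ) → ℝ) : Prop :=
  ∀ (u : Finset (Fin s)) (j : Fin s), (∀ i ∈ u, j < i) → ∀ x ∈ Set.Icc a b,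
    DifferentiableWithinAt ℝ (fun y => mixedPartial a b u f (Function.update x j y))
      (Set.Icc (a j) (b j)) (x j)

/-- The `p`-norm of the finite family `(v i)` for `i ∈ S`. -/
def lpSum {ι : Type*} (S : Finset ι) (p : ℝ≥0∞) (v : ι → ℝ≥0∞) : ℝ≥0∞ :=
  if p = ∞ then S.sup v else (∑ i ∈ S, v i ^ p.toReal) ^ (1 / p.toReal)

/-- The weighted norm `‖f‖_{p,s,γ}` on the box `[a, b]`, with values in `[0, ∞]`. -/
def weightedNorm {s : ℕ} (a b : Fin s → ℝ) (γ : Finset (Fin s) → ℝ) (p : ℝ≥0∞)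
    (f : (Fin s → ℝ) → ℝ) : ℝ≥0∞ :=
  lpSum Finset.univ p
    (fun u => ENNReal.ofReal (1 / γ u) * ⨆ x ∈ Set.Icc a b, ‖mixedPartial a b u f x‖ₑ)

/-- The quantity `G_{γ,q,a,b}(N)`, a `q`-norm over the nonempty `u ⊆ [s]`. -/
def G {s : ℕ} (γ : Finset (Fin s) → ℝ) (q : ℝ≥0∞) (a b : Fin s → ℝ) (N : ℕ) : ℝ :=
  (lpSum (Finset.univ.erase ∅) q
    (fun u => ENNReal.ofReal (γ u * ∏ j ∈ u, (3 * (b j - a j) * Real.log N)))).toReal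

/-! ### Digital nets and sequences over the field with two elements -/

/-- The square matrices `C j` of size `m` generate a digital `(t, m, s)`-net: whenever
`∑ d j = m - t`, the first `d j` rows of the `C j` form together a linearly independent system. -/
def IsDigitalNet {s : ℕ} (t m : ℕ) (C : Fin s → Matrix (Fin m) (Fin m) (ZMod 2)) : Prop :=
  t ≤ m ∧ ∀ d : Fin s → ℕ, ∑ j, d j = m - t →
    LinearIndependent (ZMod 2)
      (fun i : {i : Fin s × Fin m // (i.2 : ℕ) < d i.1} => C i.1.1 i.1.2)

/-- The upper left `m × m` submatrix. -/
def leading (C : Matrix ℕ ℕ (ZMod 2)) (m : ℕ) : Matrix (Fin m) (Fin m) (ZMod 2) :=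
  C.submatrix Fin.val Fin.val

/-- The infinite matrices `C j` (rows and columns counted from `0`) generate a digital
`(t, s)`-sequence: their columns are finitely supported and the leading submatrices generate
digital `(t, m, s)`-nets for all `m ≥ t`. -/
def GeneratesDigitalSequence {s : ℕ} (t : ℕ) (C : Fin s → Matrix ℕ ℕ (ZMod 2)) : Prop :=
  (∀ j l, ∃ K, ∀ k, K < k → C j k l = 0) ∧
    ∀ m, t ≤ m → IsDigitalNet t m (fun j => leading (C j) m)

/-- The `k`-th entry of the product of `C` with the vector of binary digits of `n`. -/
def digit (C : Matrix ℕ ℕ (ZMod 2)) (n k : ℕ) : ZMod 2 :=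
  ∑ l ∈ Finset.range n.size, C k l * ((n.testBit l).toNat : ZMod 2)

/-- The `n`-th point of the digital sequence with generating matrices `C j`. -/
def digitalSequence {s : ℕ} (C : Fin s → Matrix ℕ ℕ (ZMod 2)) (n : ℕ) : Fin s → ℝ :=
  fun j => ∑' k : ℕ, ((digit (C j) n k).val : ℝ) / 2 ^ (k + 1)

/-- Non-singular upper triangular infinite matrices. -/
def IsNonsingularUpperTriangular (C : Matrix ℕ ℕ (ZMod 2)) : Prop :=
  (∀ k l, l < k → C k l = 0) ∧ ∀ m, IsUnit (leading C m).det

/-! ### Mixtures of product densities -/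

/-- The cumulative distribution function of a density `φ` on an interval starting at `a`. -/
def cdf (a : ℝ) (φ : ℝ → ℝ) (x : ℝ) : ℝ := ∫ y in a..x, φ y

/-- The inverse on `[0, 1]` of the cumulative distribution function of `φ` on `[a, b]`. -/
def invCdf (a b : ℝ) (φ : ℝ → ℝ) : ℝ → ℝ := Function.invFunOn (cdf a φ) (Set.Icc a b)

/-- A (not necessarily normalized) mixture of product densities on the box `[a, b]`:
one-dimensional probability densities `φ j k` on `[a j, b j]` with invertible cumulative
distribution functions, and nonnegative coefficients `c k` with positive sum. -/
structure Mixture {s : ℕ} (a b : Fin s → ℝ) where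
  n : Fin s → ℕ
  φ : (j : Fin s) → Fin (n j + 1) → ℝ → ℝ
  c : ((j : Fin s) → Fin (n j + 1)) → ℝ
  φ_nonneg : ∀ j k, ∀ x ∈ Set.Icc (a j) (b j), 0 ≤ φ j k x
  φ_integrable : ∀ j k, MeasureTheory.IntegrableOn (φ j k) (Set.Icc (a j) (b j))
  φ_integral : ∀ j k, ∫ x in Set.Icc (a j) (b j), φ j k x = 1
  cdf_bijOn : ∀ j k, Set.BijOn (cdf (a j) (φ j k)) (Set.Icc (a j) (b j)) (Set.Icc 0 1)
  c_nonneg : ∀ k, 0 ≤ c k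
  c_sum_pos : 0 < ∑ k, c k

namespace Mixture

variable {s : ℕ} {a b : Fin s → ℝ} (M : Mixture a b)

/-- The set of multi-indices. -/
abbrev Index : Type := (j : Fin s) → Fin (M.n j + 1)

/-- The sum `c` of all coefficients. -/
def total : ℝ := ∑ k, M.c k

/-- The normalized density of the mixture. -/
def normalizedDensity (x : Fin s → ℝ) : ℝ :=
  (∑ k : M.Index, M.c k * ∏ j, M.φ j (k j) (x j)) / M.total

/-- The coordinatewise inverse cumulative distribution function of the component `k`. -/
def invCdfMap (k : M.Index) (y : Fin s → ℝ) : Fin s → ℝ :=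
  fun j => invCdf (a j) (b j) (M.φ j (k j)) (y j)

/-- An enumeration of the multi-indices with nonincreasing coefficients. The multi-index with
number `v` (counted from `0`) is `toEquiv v`. -/
structure Ordering where
  toEquiv : Fin (Fintype.card M.Index) ≃ M.Index
  antitone : Antitone (fun v => M.c (toEquiv v))

variable {M} (e : M.Ordering) (N : ℕ) (δ : ℝ)

/-- The smallest `r` such that the `r` largest coefficients carry at least the proportion
`1 - δ / N` of the mixture. -/
def Ordering.r : ℕ :=
  sInf {r : ℕ | 1 - δ / N ≤
    ∑ v with (v : Fin (Fintype.card M.Index)).val < r, M.c (e.toEquiv v) / M.total}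

/-- The number of points given to the component with number `v`: it is `⌊N c_k / c⌋` for the
components before the last kept one (number `r - 1`), which receives all remaining points. -/
def Ordering.size (v : Fin (Fintype.card M.Index)) : ℕ :=
  if v.val + 1 = e.r N δ then
    N - ∑ w with (w : Fin (Fintype.card M.Index)).val + 1 < e.r N δ,
      ⌊N * M.c (e.toEquiv w) / M.total⌋₊
  else ⌊N * M.c (e.toEquiv v) / M.total⌋₊

/-- The algorithm `A_{N,s}` applied to `f`, based on the sequence `y`. A kept component without
points contributes `0`. -/
def Ordering.algorithm (y : ℕ → Fin s → ℝ) (f : (Fin s → ℝ) → ℝ) : ℝ :=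
  1 / M.total * ∑ v with (v : Fin (Fintype.card M.Index)).val < e.r N δ,
    M.c (e.toEquiv v) / (e.size N δ v) *
      ∑ i ∈ Finset.range (e.size N δ v), f (M.invCdfMap (e.toEquiv v) (y i))

end Mixture

end

end MixtureQMC

namespace MixtureQMC

/-! ### Equidistribution of digital sequences -/

/-! The mixture is a convex combination of product densities, so the total error is at most the
weighted sum of the errors of its components. Write `w_v` for the normalized coefficients, `n_v` for
the point counts, `A` for the supremum of `|f|` on the box, and suppose that a component integrated
with `n > 0` points has error at most `H / n`. The dropped components have total weight at most `δ /
N` and error at most `A` each. A kept component before the last has `N w_v < n_v + 1`, so it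
contributes at most `3 (A + H) / N`, also when `n_v = 0`. The last one takes all leftover points,
has `N w_v ≤ n_v`, and contributes at most `(A + H) / N`. This gives the factor `δ + 3 (r - 1) + 1`
(`Ordering.sum_weight_mul_le`).

The bound `H / n` for one component (`abs_integral_sub_average_le`) compares the component
distribution with the empirical measure of the transported points. Since `Φ⁻¹(y) ≤ z` exactly when
`y ≤ Φ(z)`, anchored boxes correspond to anchored boxes in the unit cube, and the component measure
of a box is the volume of its image. So the discrepancy of the digital sequence itself
(`abs_card_box_sub_le`) controls both measures on boxes. A Koksma-Hlawka inequality for two measures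
(`abs_integral_sub_le`) turns this into a bound for integrals, with the suprema of the mixed
partials as coefficients. Only existence and boundedness of these partials are assumed, so their
measurability has to be proved.

The discrepancy bound rests on linear algebra over `ZMod 2`: linear independence of the selected
rows puts exactly `2 ^ t` points of each aligned block in each elementary interval. Hence any
initial segment errs by at most `2 ^ t` per interval, and a box with dyadic corner of resolution `L`
splits into at most `L ^ |u|` such intervals.

Finally Hölder's inequality bounds `H` by the norm times `G`, and `γ ∅ ≤ 1` bounds `A` by the norm
(`sum_partialSup_mul_le`, `partialSup_empty_le`). -/

lemma card_mulVec_fiber {ι : Type*} [Fintype ι] [DecidableEq ι] {m : ℕ}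
    (A : Matrix ι (Fin m) (ZMod 2)) (hA : LinearIndependent (ZMod 2) A) (b : ι → ZMod 2) :
    2 ^ Fintype.card ι * (Finset.univ.filter (fun x => A.mulVec x = b)).card = 2 ^ m := by
  -- Independent rows give full row rank, so the map is onto and all its fibers are cosets of the
  -- kernel, of equal size.
  have hsurj : Function.Surjective A.mulVecLin := by
    rw [← LinearMap.range_eq_top]
    apply Submodule.eq_top_of_finrank_eq
    have h := LinearIndependent.rank_matrix (M := A) hA
    rw [Matrix.rank] at h
    rw [h, Module.finrank_fintype_fun_eq_card]
  have hfib : ∀ c : ι → ZMod 2, (Finset.univ.filter (fun x => A.mulVec x = c)).card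
      = (Finset.univ.filter (fun x => A.mulVec x = b)).card := fun c =>
    AddMonoidHom.card_fiber_eq_of_mem_range A.mulVecLin (hsurj c) (hsurj b)
  have h := Finset.card_eq_sum_card_fiberwise (f := fun x : Fin m → ZMod 2 => A.mulVec x)
    (s := Finset.univ) (t := Finset.univ) (fun _ _ => Finset.mem_coe.2 (Finset.mem_univ _))
  rw [Finset.sum_congr rfl (fun c _ => hfib c)] at h
  simpa [ZMod.card] using h.symm

/-- The integer whose binary expansion consists of the first `k` digits of the `n`-th point. -/
def digitPrefix (C : Matrix ℕ ℕ (ZMod 2)) (n : ℕ) : ℕ → ℕ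
  | 0 => 0
  | k + 1 => 2 * digitPrefix C n k + (digit C n k).val

lemma digitPrefix_lt (C : Matrix ℕ ℕ (ZMod 2)) (n k : ℕ) : digitPrefix C n k < 2 ^ k := by
  induction k with
  | zero => simp [digitPrefix]
  | succ k ih =>
    have := ZMod.val_lt (digit C n k)
    simp only [digitPrefix, pow_succ]
    omega

lemma digitPrefix_add_div (C : Matrix ℕ ℕ (ZMod 2)) (n k i : ℕ) :
    digitPrefix C n (k + i) / 2 ^ i = digitPrefix C n k := by
  induction i with
  | zero => simp
  | succ i ih =>
    have := ZMod.val_lt (digit C n (k + i))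
    rw [← ih, pow_succ', ← Nat.div_div_eq_div_mul, ← add_assoc, digitPrefix]
    congr 1
    omega

/-- Prefixes are read most significant digit first, so the last digit is `c % 2` and the earlier
ones encode `c / 2`. The target digits depend on neither the matrix nor `n`, so membership in an
elementary interval becomes a linear system with fixed target. -/
lemma exists_digitPrefix_eq_iff (k c : ℕ) (hc : c < 2 ^ k) :
    ∃ b : ℕ → ZMod 2, ∀ (C : Matrix ℕ ℕ (ZMod 2)) (n : ℕ),
      digitPrefix C n k = c ↔ ∀ i < k, digit C n i = b i := by
  induction k generalizing c with
  | zero => exact ⟨0, fun C n => by simp [digitPrefix]; simp at hc; exact hc.symm⟩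
  | succ k ih =>
    obtain ⟨b, hb⟩ := ih (c / 2) (by rw [pow_succ] at hc; omega)
    refine ⟨fun i => if i = k then ((c % 2 : ℕ) : ZMod 2) else b i, fun C n => ?_⟩
    have hv := ZMod.val_lt (digit C n k)
    have h1 : digit C n k = ((c % 2 : ℕ) : ZMod 2) ↔ (digit C n k).val = c % 2 := by
      constructor
      · intro h; rw [h, ZMod.val_natCast, Nat.mod_mod]
      · intro h; rw [← h, ZMod.natCast_zmod_val]
    have h2 : digitPrefix C n (k + 1) = c ↔
        digitPrefix C n k = c / 2 ∧ (digit C n k).val = c % 2 := by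
      simp only [digitPrefix]; omega
    rw [h2, hb, ← h1]
    constructor
    · rintro ⟨h, h'⟩ i hi
      dsimp only
      split_ifs with hik
      · rw [hik, h']
      · exact h i (by omega)
    · intro h
      refine ⟨fun i hi => ?_, by simpa using h k (by omega)⟩
      simpa [hi.ne] using h i (by omega)

lemma digit_eq_sum_range (C : Matrix ℕ ℕ (ZMod 2)) (n k R : ℕ) (hn : n < 2 ^ R) :
    digit C n k = ∑ l ∈ Finset.range R, C k l * ((n.testBit l).toNat : ZMod 2) := by
  unfold digit
  apply Finset.sum_subset
  · intro l hl
    have := Nat.size_le.2 hn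
    simp only [Finset.mem_range] at *
    omega
  · intro l _ hl
    have : n < 2 ^ l := Nat.size_le.1 (by simpa using hl)
    simp [Nat.testBit_lt_two_pow this]

/-- The binary digits of `i` and `Q` occupy disjoint positions; within a block each output digit is
thus an affine function of the low bits, with a constant determined by `Q`. -/
lemma digit_two_pow_mul_add (C : Matrix ℕ ℕ (ZMod 2)) (m Q i k : ℕ) (hi : i < 2 ^ m) :
    digit C (2 ^ m * Q + i) k
      = (∑ l : Fin m, C k l * ((i.testBit l).toNat : ZMod 2))
        + ∑ l ∈ Finset.range Q.size, C k (m + l) * ((Q.testBit l).toNat : ZMod 2) := by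
  have hlt : 2 ^ m * Q + i < 2 ^ (m + Q.size) := by
    have := Nat.lt_size_self Q
    rw [pow_add]
    calc 2 ^ m * Q + i < 2 ^ m * Q + 2 ^ m := by omega
      _ = 2 ^ m * (Q + 1) := by ring
      _ ≤ _ := Nat.mul_le_mul_left _ this
  rw [digit_eq_sum_range _ _ _ _ hlt, Finset.sum_range_add, Finset.sum_range]
  congr 1
  · refine Finset.sum_congr rfl fun l _ => ?_
    rw [Nat.testBit_two_pow_mul_add _ hi, if_pos l.2]
  · refine Finset.sum_congr rfl fun l _ => ?_
    rw [Nat.testBit_two_pow_mul_add _ hi, if_neg (by omega)]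
    simp

lemma bijective_bitVector (m : ℕ) : Function.Bijective
    (fun (i : Fin (2 ^ m)) (l : Fin m) => (((i : ℕ).testBit l).toNat : ZMod 2)) := by
  rw [Fintype.bijective_iff_injective_and_card]
  refine ⟨fun i i' h => ?_, by simp [ZMod.card]⟩
  ext
  apply Nat.eq_of_testBit_eq
  intro l
  by_cases hl : l < m
  · have := congrFun h ⟨l, hl⟩
    simp only at this
    revert this
    cases (i : ℕ).testBit l <;> cases (i' : ℕ).testBit l <;> simp
  · have h2 : 2 ^ m ≤ 2 ^ l := Nat.pow_le_pow_right (by norm_num) (by omega)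
    rw [Nat.testBit_lt_two_pow (i.2.trans_le h2), Nat.testBit_lt_two_pow (i'.2.trans_le h2)]

/-- In every block of `2 ^ m` points, an elementary interval of order `m - t` contains exactly
`2 ^ t` points. -/
lemma card_elementary_block {s t m : ℕ} {C : Fin s → Matrix ℕ ℕ (ZMod 2)}
    (hC : IsDigitalNet t m (fun j => leading (C j) m)) (d c : Fin s → ℕ)
    (hd : ∑ j, d j = m - t) (hc : ∀ j, c j < 2 ^ d j) (Q : ℕ) :
    ((Finset.range (2 ^ m)).filter
      (fun i => ∀ j, digitPrefix (C j) (2 ^ m * Q + i) (d j) = c j)).card = 2 ^ t := by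
  choose b hb using fun j => exists_digitPrefix_eq_iff (d j) (c j) (hc j)
  have hdm : ∀ j, d j ≤ m := fun j =>
    (Finset.single_le_sum (fun _ _ => Nat.zero_le _) (Finset.mem_univ j)).trans
      (hd.le.trans (Nat.sub_le _ _))
  let ι := {i : Fin s × Fin m // (i.2 : ℕ) < d i.1}
  have hcard : Fintype.card ι = m - t := by
    rw [← hd, Fintype.card_subtype, Finset.card_filter, Fintype.sum_prod_type]
    refine Finset.sum_congr rfl fun j _ => ?_
    rw [← Finset.card_filter]
    dsimp only
    rw [Fin.card_filter_val_lt]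
    exact min_eq_right (hdm j)
  let A : Matrix ι (Fin m) (ZMod 2) := fun i l => leading (C i.1.1) m i.1.2 l
  have hA : LinearIndependent (ZMod 2) A := hC.2 d hd
  -- The contribution of the block number `Q`. It only shifts the right-hand side of the system, and
  -- the fiber count does not depend on that side.
  let e : ι → ZMod 2 := fun i =>
    ∑ l ∈ Finset.range Q.size, C i.1.1 i.1.2 (m + l) * ((Q.testBit l).toNat : ZMod 2)
  have h1 := card_mulVec_fiber A hA (fun i => b i.1.1 i.1.2 - e i)
  have h2 : ((Finset.range (2 ^ m)).filter
      (fun i => ∀ j, digitPrefix (C j) (2 ^ m * Q + i) (d j) = c j)).card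
      = (Finset.univ.filter (fun x => A.mulVec x = fun i => b i.1.1 i.1.2 - e i)).card := by
    refine Finset.card_bij
      (fun i _ => fun l : Fin m => ((i.testBit l).toNat : ZMod 2)) ?_ ?_ ?_
    · intro i hi
      simp only [Finset.mem_filter, Finset.mem_range, Finset.mem_univ, true_and] at hi ⊢
      ext ⟨⟨j, k⟩, hk⟩
      have := (hb j (C j) _).1 (hi.2 j) k hk
      rw [digit_two_pow_mul_add _ _ _ _ _ hi.1] at this
      rw [← this]
      simp [A, e, Matrix.mulVec, dotProduct, leading]
    · intro i hi i' hi' h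
      simp only [Finset.mem_filter, Finset.mem_range] at hi hi'
      have := (bijective_bitVector m).1 (a₁ := ⟨i, hi.1⟩) (a₂ := ⟨i', hi'.1⟩) h
      simpa using this
    · intro x hx
      obtain ⟨i, rfl⟩ := (bijective_bitVector m).2 x
      simp only [Finset.mem_filter, Finset.mem_univ, true_and] at hx
      refine ⟨i, ?_, rfl⟩
      simp only [Finset.mem_filter, Finset.mem_range]
      refine ⟨i.2, fun j => (hb j (C j) _).2 fun k hk => ?_⟩
      rw [digit_two_pow_mul_add _ _ _ _ _ i.2]
      have := congrFun hx ⟨⟨j, ⟨k, hk.trans_le (hdm j)⟩⟩, hk⟩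
      simp only [A, e, Matrix.mulVec, dotProduct, leading, Matrix.submatrix_apply] at this
      rw [this]
      ring
  rw [h2]
  rw [hcard] at h1
  have h3 : (2 : ℕ) ^ m = 2 ^ (m - t) * 2 ^ t := by rw [← pow_add, Nat.sub_add_cancel hC.1]
  rw [h3] at h1
  exact Nat.eq_of_mul_eq_mul_left (by positivity) h1

/-- The first `M` points hit an elementary interval as often as its volume predicts, up to an
error of at most `2 ^ t`. -/
lemma abs_card_elementary_sub_le {s t : ℕ} {C : Fin s → Matrix ℕ ℕ (ZMod 2)}
    (hC : ∀ m, t ≤ m → IsDigitalNet t m (fun j => leading (C j) m)) (d c : Fin s → ℕ)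
    (hc : ∀ j, c j < 2 ^ d j) (M : ℕ) :
    |(((Finset.range M).filter (fun n => ∀ j, digitPrefix (C j) n (d j) = c j)).card : ℝ)
      - M * ∏ j, (1 / 2 ^ d j : ℝ)| ≤ 2 ^ t := by
  set K := ∑ j, d j with hK
  -- Blocks of length `2 ^ (t + K)` are those for which an interval of volume `2 ^ (-K)` has order
  -- exactly `m - t`.
  have hblock := card_elementary_block (hC (t + K) (by omega)) d c (by omega) hc
  set P : ℕ → Prop := fun n => ∀ j, digitPrefix (C j) n (d j) = c j with hP
  set B := 2 ^ (t + K) with hB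
  have hB0 : 0 < B := by positivity
  have hfull : ∀ Q, ((Finset.range (B * Q)).filter P).card = Q * 2 ^ t := by
    intro Q
    induction Q with
    | zero => simp
    | succ Q ih =>
      rw [Finset.card_filter] at ih ⊢
      rw [mul_add, mul_one, Finset.sum_range_add, ih, ← Finset.card_filter, hblock Q]
      ring
  have hM := Nat.div_add_mod M B
  set Q := M / B
  set R := M % B
  have hR : R < B := Nat.mod_lt _ hB0
  have hcount : ((Finset.range M).filter P).card
      = Q * 2 ^ t + ((Finset.range R).filter (fun i => P (B * Q + i))).card := by
    rw [← hM, Finset.card_filter, Finset.sum_range_add, ← Finset.card_filter, hfull,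
      ← Finset.card_filter]
  have hrem : ((Finset.range R).filter (fun i => P (B * Q + i))).card ≤ 2 ^ t := by
    rw [← hblock Q]
    exact Finset.card_le_card (Finset.filter_subset_filter _ (Finset.range_subset_range.2 hR.le))
  have hvol : ∏ j, (1 / 2 ^ d j : ℝ) = 1 / 2 ^ K := by
    rw [Finset.prod_div_distrib, Finset.prod_const_one, Finset.prod_pow_eq_pow_sum]
  rw [hcount, hvol, ← hM]
  have hBr : (B : ℝ) = 2 ^ t * 2 ^ K := by rw [hB]; push_cast; rw [pow_add]
  have hRr : (R : ℝ) * (1 / 2 ^ K) ≤ 2 ^ t := by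
    rw [mul_one_div, div_le_iff₀ (by positivity), ← hBr]
    exact_mod_cast hR.le
  have hR0 : (0 : ℝ) ≤ (R : ℝ) * (1 / 2 ^ K) := by positivity
  have hremr : (((Finset.range R).filter (fun i => P (B * Q + i))).card : ℝ) ≤ 2 ^ t := by
    exact_mod_cast hrem
  push_cast
  rw [hBr]
  have : (2 ^ t * 2 ^ K * (Q : ℝ) + R) * (1 / 2 ^ K) = Q * 2 ^ t + R * (1 / 2 ^ K) := by
    field_simp
  -- Full blocks match exactly. In the incomplete block both the actual and the expected count lie
  -- in `[0, 2 ^ t]`, so they differ by at most `2 ^ t`.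
  rw [this, abs_le]
  have h0 : (0 : ℝ) ≤ (((Finset.range R).filter (fun i => P (B * Q + i))).card : ℝ) := by
    positivity
  constructor <;> linarith

/-- An initial segment of `{0, …, 2 ^ L - 1}` is a disjoint union of at most `max L 1` dyadic
intervals. -/
lemma exists_dyadic_decomposition (L x : ℕ) (hx : x ≤ 2 ^ L) :
    ∃ I : Finset (ℕ × ℕ), (x < 2 ^ L → I.card ≤ L) ∧ (x = 2 ^ L → I.card ≤ 1) ∧
      (∀ i ∈ I, i.1 ≤ L ∧ i.2 < 2 ^ i.1) ∧
      (∀ y : ℕ, (if y < x then (1 : ℝ) else 0)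
        = ∑ i ∈ I, if y / 2 ^ (L - i.1) = i.2 then (1 : ℝ) else 0) ∧
      (x : ℝ) / 2 ^ L = ∑ i ∈ I, (1 / 2 ^ i.1 : ℝ) := by
  induction L generalizing x with
  | zero =>
    obtain rfl | rfl : x = 0 ∨ x = 1 := by simp at hx; omega
    · exact ⟨∅, by simp⟩
    · refine ⟨{(0, 0)}, by simp, by simp, by simp, fun y => ?_, by simp⟩
      rw [Finset.sum_singleton]
      simp
  | succ L ih =>
    rw [pow_succ] at hx
    -- A pair `(d, c)` stands for `[c / 2 ^ d, (c + 1) / 2 ^ d)`, a meaning independent of the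
    -- resolution, so the intervals for `x / 2` can be reused. If `x` is odd, one cell of the finest
    -- level is added.
    obtain ⟨I, h1, h2, h3, h4, h5⟩ := ih (x / 2) (by omega)
    have hdiv : ∀ y : ℕ, ∀ i ∈ I, y / 2 ^ (L + 1 - i.1) = y / 2 / 2 ^ (L - i.1) := by
      intro y i hi
      rw [Nat.div_div_eq_div_mul, ← pow_succ', Nat.sub_add_comm (h3 i hi).1]
    rcases Nat.even_or_odd' x with ⟨z, rfl | rfl⟩
    · refine ⟨I, fun h => ?_, fun h => h2 ?_, fun i hi => ⟨?_, (h3 i hi).2⟩, fun y => ?_, ?_⟩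
      · exact (h1 (by rw [pow_succ] at h; omega)).trans (Nat.le_succ L)
      · rw [pow_succ] at h; omega
      · exact (h3 i hi).1.trans (Nat.le_succ L)
      · rw [Finset.sum_congr rfl fun i hi => by rw [hdiv y i hi], ← h4]
        congr 1
        simp only [eq_iff_iff]
        omega
      · rw [← h5, pow_succ, Nat.mul_div_cancel_left _ (by norm_num)]
        push_cast
        field_simp
    · have hz : (2 * z + 1) / 2 = z := by omega
      rw [hz] at h1 h2 h4 h5
      have hzL : z < 2 ^ L := by omega
      have hnot : (L + 1, 2 * z) ∉ I := fun h => by have := (h3 _ h).1; simp at this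
      refine ⟨insert (L + 1, 2 * z) I, fun h => ?_, fun h => ?_, fun i hi => ?_, fun y => ?_, ?_⟩
      · rw [Finset.card_insert_of_notMem hnot]
        exact Nat.succ_le_succ (h1 hzL)
      · rw [pow_succ] at h; omega
      · rcases Finset.mem_insert.1 hi with rfl | hi
        · exact ⟨le_rfl, by simp only [pow_succ]; omega⟩
        · exact ⟨(h3 i hi).1.trans (Nat.le_succ L), (h3 i hi).2⟩
      · rw [Finset.sum_insert hnot, Finset.sum_congr rfl fun i hi => by rw [hdiv y i hi], ← h4]
        simp only [Nat.sub_self, pow_zero, Nat.div_one]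
        split_ifs <;> first | omega | simp
      · rw [Finset.sum_insert hnot, ← h5]
        push_cast
        field_simp
        ring

end MixtureQMC

namespace MixtureQMC

/-! ### Discrepancy of digital sequences on anchored boxes -/

lemma sum_digit_div_eq (C : Matrix ℕ ℕ (ZMod 2)) (n K : ℕ) :
    ∑ k ∈ Finset.range K, ((digit C n k).val : ℝ) / 2 ^ (k + 1) = digitPrefix C n K / 2 ^ K := by
  induction K with
  | zero => simp [digitPrefix]
  | succ K ih =>
    rw [Finset.sum_range_succ, ih, digitPrefix]
    push_cast
    field_simp
    ring

lemma exists_digit_eq_zero {C : Matrix ℕ ℕ (ZMod 2)} (hC : ∀ l, ∃ K, ∀ k, K < k → C k l = 0)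
    (n : ℕ) : ∃ K, ∀ k, K ≤ k → digit C n k = 0 := by
  choose K hK using hC
  refine ⟨(Finset.range n.size).sup K + 1, fun k hk => ?_⟩
  refine Finset.sum_eq_zero fun l hl => ?_
  have := Finset.le_sup (f := K) hl
  rw [hK l k (by omega), zero_mul]

/-- The first `k` digits of a point of the digital sequence locate it in an interval of length
`2 ^ (-k)`. -/
lemma digitPrefix_le_and_lt {s : ℕ} {C : Fin s → Matrix ℕ ℕ (ZMod 2)}
    (hC : ∀ j l, ∃ K, ∀ k, K < k → C j k l = 0) (n k : ℕ) (j : Fin s) :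
    (digitPrefix (C j) n k : ℝ) / 2 ^ k ≤ digitalSequence C n j ∧
      digitalSequence C n j < (digitPrefix (C j) n k + 1) / 2 ^ k := by
  obtain ⟨K, hK⟩ := exists_digit_eq_zero (hC j) n
  have h1 : digitalSequence C n j = digitPrefix (C j) n (k + K) / 2 ^ (k + K) := by
    rw [← sum_digit_div_eq]
    apply tsum_eq_sum
    intro i hi
    rw [hK i (by simp at hi; omega)]
    simp
  have h2 := digitPrefix_add_div (C j) n k K
  have h3 : digitPrefix (C j) n k * 2 ^ K ≤ digitPrefix (C j) n (k + K) := by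
    rw [← h2]; exact Nat.div_mul_le_self _ _
  have h4 : digitPrefix (C j) n (k + K) < (digitPrefix (C j) n k + 1) * 2 ^ K := by
    rw [← h2, mul_comm]; exact Nat.lt_mul_div_succ _ (by positivity)
  have h3' : (digitPrefix (C j) n k : ℝ) * 2 ^ K ≤ digitPrefix (C j) n (k + K) := by
    exact_mod_cast h3
  have h4' : (digitPrefix (C j) n (k + K) : ℝ) < (digitPrefix (C j) n k + 1) * 2 ^ K := by
    exact_mod_cast h4
  rw [h1, pow_add]
  constructor
  · rw [div_le_div_iff₀ (by positivity) (by positivity)]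
    nlinarith [pow_pos (two_pos (α := ℝ)) k]
  · rw [div_lt_div_iff₀ (by positivity) (by positivity)]
    nlinarith [pow_pos (two_pos (α := ℝ)) k]

lemma digitalSequence_mem_Icc {s : ℕ} {C : Fin s → Matrix ℕ ℕ (ZMod 2)}
    (hC : ∀ j l, ∃ K, ∀ k, K < k → C j k l = 0) (n : ℕ) (j : Fin s) :
    digitalSequence C n j ∈ Set.Icc (0 : ℝ) 1 := by
  have := digitPrefix_le_and_lt hC n 0 j
  simp only [digitPrefix, pow_zero] at this
  norm_num at this
  exact ⟨this.1, this.2.le⟩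

/-- Telescoping: exchanging one factor at a time costs its difference times factors in `[0, 1]`. -/
lemma abs_prod_sub_prod_le {ι : Type*} (u : Finset ι) (f g : ι → ℝ)
    (hf : ∀ i ∈ u, f i ∈ Set.Icc (0 : ℝ) 1) (hg : ∀ i ∈ u, g i ∈ Set.Icc (0 : ℝ) 1) :
    |∏ i ∈ u, f i - ∏ i ∈ u, g i| ≤ ∑ i ∈ u, |f i - g i| := by
  classical
  induction u using Finset.induction_on with
  | empty => simp
  | insert j u hj ih =>
    have ih := ih (fun i hi => hf i (Finset.mem_insert_of_mem hi))
      (fun i hi => hg i (Finset.mem_insert_of_mem hi))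
    have hfj := hf j (Finset.mem_insert_self j u)
    have hG0 : 0 ≤ ∏ i ∈ u, g i :=
      Finset.prod_nonneg fun i hi => (hg i (Finset.mem_insert_of_mem hi)).1
    have hG1 : ∏ i ∈ u, g i ≤ 1 :=
      Finset.prod_le_one (fun i hi => (hg i (Finset.mem_insert_of_mem hi)).1)
        (fun i hi => (hg i (Finset.mem_insert_of_mem hi)).2)
    rw [Finset.prod_insert hj, Finset.prod_insert hj, Finset.sum_insert hj]
    calc |f j * ∏ i ∈ u, f i - g j * ∏ i ∈ u, g i|
        = |(f j - g j) * ∏ i ∈ u, g i + f j * (∏ i ∈ u, f i - ∏ i ∈ u, g i)| := by ring_nf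
      _ ≤ |(f j - g j) * ∏ i ∈ u, g i| + |f j * (∏ i ∈ u, f i - ∏ i ∈ u, g i)| :=
        abs_add_le _ _
      _ = |f j - g j| * ∏ i ∈ u, g i + f j * |∏ i ∈ u, f i - ∏ i ∈ u, g i| := by
        rw [abs_mul, abs_mul, abs_of_nonneg hG0, abs_of_nonneg hfj.1]
      _ ≤ _ := by
        have := mul_le_of_le_one_right (abs_nonneg (f j - g j)) hG1
        have := mul_le_of_le_one_left (abs_nonneg (∏ i ∈ u, f i - ∏ i ∈ u, g i)) hfj.2
        linarith

/-- Discrepancy bound for boxes whose corner is dyadic of resolution `L`. -/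
lemma abs_card_dyadicBox_sub_le {s t : ℕ} {C : Fin s → Matrix ℕ ℕ (ZMod 2)}
    (hC : ∀ m, t ≤ m → IsDigitalNet t m (fun j => leading (C j) m)) (u : Finset (Fin s))
    (L : ℕ) (hL : 1 ≤ L) (x : Fin s → ℕ) (hx : ∀ j, x j ≤ 2 ^ L) (M : ℕ) :
    |(((Finset.range M).filter (fun n => ∀ j ∈ u, digitPrefix (C j) n L < x j)).card : ℝ)
      - M * ∏ j ∈ u, ((x j : ℝ) / 2 ^ L)| ≤ 2 ^ t * (L : ℝ) ^ u.card := by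
  choose I₀ h1 h2 h3 h4 h5 using fun j => exists_dyadic_decomposition L (x j) (hx j)
  -- Unconstrained coordinates receive the single interval `(0, 0)`, the whole of `[0, 1)`, so they
  -- neither increase the number of pieces nor change the volume.
  let I : Fin s → Finset (ℕ × ℕ) := fun j => if j ∈ u then I₀ j else {(0, 0)}
  have hI₀ : ∀ j, (I₀ j).card ≤ L := fun j =>
    (hx j).lt_or_eq.elim (h1 j) fun h => (h2 j h).trans hL
  have hIcard : ((Fintype.piFinset I).card : ℝ) ≤ (L : ℝ) ^ u.card := by
    have : (Fintype.piFinset I).card ≤ L ^ u.card := by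
      rw [Fintype.card_piFinset, ← Finset.prod_const, ← Finset.prod_subset (Finset.subset_univ u)]
      · refine Finset.prod_le_prod' fun j hj => ?_
        simp only [I, if_pos hj]
        exact hI₀ j
      · intro j _ hj
        simp [I, hj]
    exact_mod_cast this
  have hImem : ∀ i ∈ Fintype.piFinset I, ∀ j, (i j).1 ≤ L ∧ (i j).2 < 2 ^ (i j).1 := by
    intro i hi j
    have hij := Fintype.mem_piFinset.1 hi j
    by_cases hj : j ∈ u
    · simp only [I, if_pos hj] at hij
      exact h3 j _ hij
    · simp only [I, if_neg hj, Finset.mem_singleton] at hij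
      simp [hij]
  have hcount : (((Finset.range M).filter (fun n => ∀ j ∈ u, digitPrefix (C j) n L < x j)).card : ℝ)
      = ∑ i ∈ Fintype.piFinset I, (((Finset.range M).filter
          (fun n => ∀ j, digitPrefix (C j) n (i j).1 = (i j).2)).card : ℝ) := by
    simp only [Finset.card_filter]
    push_cast
    rw [Finset.sum_comm]
    refine Finset.sum_congr rfl fun n _ => ?_
    have e1 : (if ∀ j ∈ u, digitPrefix (C j) n L < x j then (1 : ℝ) else 0)
        = ∏ j, ∑ i ∈ I j, if digitPrefix (C j) n i.1 = i.2 then (1 : ℝ) else 0 := by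
      have : ∀ j, (∑ i ∈ I j, if digitPrefix (C j) n i.1 = i.2 then (1 : ℝ) else 0)
          = if j ∈ u → digitPrefix (C j) n L < x j then 1 else 0 := by
        intro j
        by_cases hj : j ∈ u
        · simp only [I, if_pos hj, hj, true_imp_iff]
          rw [h4]
          refine Finset.sum_congr rfl fun i hi => ?_
          have := digitPrefix_add_div (C j) n i.1 (L - i.1)
          rw [Nat.add_sub_cancel' (h3 j i hi).1] at this
          rw [this]
        · simp only [I, if_neg hj]
          rw [Finset.sum_singleton]
          simp [hj, digitPrefix]
      rw [Finset.prod_congr rfl fun j _ => this j, Finset.prod_ite_zero]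
      simp
    rw [e1, Finset.prod_univ_sum]
    refine Finset.sum_congr rfl fun i _ => ?_
    rw [Finset.prod_ite_zero]
    simp
  have hvol : ∏ j ∈ u, ((x j : ℝ) / 2 ^ L)
      = ∑ i ∈ Fintype.piFinset I, ∏ j, (1 / 2 ^ (i j).1 : ℝ) := by
    rw [← Finset.prod_univ_sum (fun j => I j) (fun _ i => (1 / 2 ^ i.1 : ℝ)),
      ← Finset.prod_subset (Finset.subset_univ u)]
    · refine Finset.prod_congr rfl fun j hj => ?_
      simp only [I, if_pos hj]
      exact h5 j
    · intro j _ hj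
      simp [I, hj]
  rw [hcount, hvol, Finset.mul_sum, ← Finset.sum_sub_distrib]
  calc _ ≤ ∑ i ∈ Fintype.piFinset I, (2 : ℝ) ^ t := by
        refine (Finset.abs_sum_le_sum_abs _ _).trans (Finset.sum_le_sum fun i hi => ?_)
        exact abs_card_elementary_sub_le hC (fun j => (i j).1) (fun j => (i j).2)
          (fun j => (hImem i hi j).2) M
    _ = (Fintype.piFinset I).card * 2 ^ t := by rw [Finset.sum_const, nsmul_eq_mul]
    _ ≤ _ := by rw [mul_comm]; gcongr

/-- A slab of width `2 ^ (-L)` in one coordinate is an elementary interval with expected count `M /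
2 ^ L ≤ 1`. It pays for rounding a box corner to the dyadic grid. The case `2 ^ L ≤ c`, which arises
when the corner coordinate is `1`, is an empty slab. -/
lemma card_slab_le {s t : ℕ} {C : Fin s → Matrix ℕ ℕ (ZMod 2)}
    (hC : ∀ m, t ≤ m → IsDigitalNet t m (fun j => leading (C j) m)) (L M : ℕ) (hM : M ≤ 2 ^ L)
    (j : Fin s) (c : ℕ) :
    (((Finset.range M).filter (fun n => digitPrefix (C j) n L = c)).card : ℝ) ≤ 1 + 2 ^ t := by
  by_cases hc : c < 2 ^ L
  · have h := abs_card_elementary_sub_le hC (Pi.single j L) (Pi.single j c) (fun i => by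
      by_cases hij : i = j
      · subst hij; simpa using hc
      · simp [hij]) M
    have hP : ∀ n, (∀ i, digitPrefix (C i) n (Pi.single (M := fun _ => ℕ) j L i)
        = Pi.single (M := fun _ => ℕ) j c i) ↔ digitPrefix (C j) n L = c := by
      intro n
      refine ⟨fun h => by simpa using h j, fun h i => ?_⟩
      by_cases hij : i = j
      · subst hij; simpa using h
      · simp [hij, digitPrefix]
    simp only [hP] at h
    have hv : ∏ i, (1 / 2 ^ (Pi.single (M := fun _ => ℕ) j L i) : ℝ) = 1 / 2 ^ L := by
      rw [Finset.prod_eq_single j]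
      · simp
      · intro i _ hij; simp [hij]
      · simp
    rw [hv] at h
    have h2 : (M : ℝ) * (1 / 2 ^ L) ≤ 1 := by
      rw [mul_one_div, div_le_one (by positivity)]
      exact_mod_cast hM
    linarith [(abs_le.1 h).2]
  · have : (Finset.range M).filter (fun n => digitPrefix (C j) n L = c) = ∅ := by
      refine Finset.filter_eq_empty_iff.2 fun n _ h => hc ?_
      rw [← h]; exact digitPrefix_lt _ _ _
    rw [this]
    simp only [Finset.card_empty, Nat.cast_zero]
    positivity

/-- Since `2 ^ (L - 1) < N` and `2 ≤ N`, one has `L log 2 ≤ 2 log N`, and `2 / log 2 < 3`. -/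
lemma clog_le_three_mul_log {N : ℕ} (hN : 2 ≤ N) : (Nat.clog 2 N : ℝ) ≤ 3 * Real.log N := by
  have h1 : 1 ≤ Nat.clog 2 N := Nat.clog_pos (by norm_num) hN
  have h2 : 2 ^ (Nat.clog 2 N).pred < N := Nat.pow_pred_clog_lt_self (by norm_num) hN
  have h3 : ((Nat.clog 2 N : ℝ) - 1) * Real.log 2 ≤ Real.log N := by
    have : Real.log ((2 : ℝ) ^ (Nat.clog 2 N).pred) ≤ Real.log N :=
      Real.log_le_log (by positivity) (by exact_mod_cast h2.le)
    rw [Real.log_pow, Nat.pred_eq_sub_one, Nat.cast_sub h1] at this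
    simpa using this
  have h4 : Real.log 2 ≤ Real.log N :=
    Real.log_le_log (by norm_num) (by exact_mod_cast hN)
  have h5 := Real.log_two_gt_d9
  have h6 : (1 : ℝ) ≤ Nat.clog 2 N := by exact_mod_cast h1
  nlinarith

/-- Discrepancy bound for the first `M ≤ N` points of a digital `(t, s)`-sequence and anchored
closed boxes in the coordinates `u`. -/
theorem abs_card_box_sub_le {s t : ℕ} {C : Fin s → Matrix ℕ ℕ (ZMod 2)}
    (hC : GeneratesDigitalSequence t C) (u : Finset (Fin s)) (x : Fin s → ℝ)
    (hx : ∀ j, x j ∈ Set.Icc (0 : ℝ) 1) {M N : ℕ} (hMN : M ≤ N) (hN : 2 ≤ N) :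
    |(((Finset.range M).filter (fun n => ∀ j ∈ u, digitalSequence C n j ≤ x j)).card : ℝ)
      - M * ∏ j ∈ u, x j| ≤ 5 * 2 ^ t * Real.log (2 * N) * (3 * Real.log N) ^ u.card := by
  obtain ⟨hfin, hnet⟩ := hC
  set L := Nat.clog 2 N with hLdef
  have hL : 1 ≤ L := Nat.clog_pos (by norm_num) hN
  have hM : M ≤ 2 ^ L := hMN.trans (Nat.le_pow_clog (by norm_num) N)
  let c : Fin s → ℕ := fun j => ⌊x j * 2 ^ L⌋₊
  have hc0 : ∀ j, (c j : ℝ) / 2 ^ L ≤ x j := fun j => by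
    rw [div_le_iff₀ (by positivity)]
    exact Nat.floor_le (mul_nonneg (hx j).1 (by positivity))
  have hc1 : ∀ j, x j < ((c j : ℝ) + 1) / 2 ^ L := fun j => by
    rw [lt_div_iff₀ (by positivity)]
    exact Nat.lt_floor_add_one _
  have hcL : ∀ j, c j ≤ 2 ^ L := fun j => by
    have h : (c j : ℝ) ≤ 2 ^ L := by
      have := (hc0 j).trans (hx j).2
      rwa [div_le_one (by positivity)] at this
    exact_mod_cast h
  set P : ℕ → Prop := fun n => ∀ j ∈ u, digitalSequence C n j ≤ x j with hP
  set P' : ℕ → Prop := fun n => ∀ j ∈ u, digitPrefix (C j) n L < c j with hP'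
  have hdy := abs_card_dyadicBox_sub_le hnet u L hL c hcL M
  have hlo : ((Finset.range M).filter P').card ≤ ((Finset.range M).filter P).card := by
    refine Finset.card_le_card (Finset.monotone_filter_right _ fun n _ h j hj => ?_)
    have h1 := (digitPrefix_le_and_lt hfin n L j).2
    have h2 : (digitPrefix (C j) n L : ℝ) + 1 ≤ c j := by exact_mod_cast h j hj
    refine h1.le.trans (le_trans ?_ (hc0 j))
    gcongr
  -- A point of the box outside the rounded box has, in some coordinate, a prefix that is at least
  -- `c j` but below `c j + 1`; it lies in the slab at `c j`.
  have hhi : ((Finset.range M).filter P).card ≤ ((Finset.range M).filter P').card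
      + ∑ j ∈ u, ((Finset.range M).filter (fun n => digitPrefix (C j) n L = c j)).card := by
    refine le_trans (Finset.card_le_card (t := (Finset.range M).filter P' ∪ u.biUnion fun j =>
      (Finset.range M).filter (fun n => digitPrefix (C j) n L = c j)) ?_) ?_
    · intro n hn
      simp only [Finset.mem_union, Finset.mem_filter, Finset.mem_biUnion] at hn ⊢
      by_cases h : P' n
      · exact Or.inl ⟨hn.1, h⟩
      · right
        simp only [hP', not_forall, not_lt] at h
        obtain ⟨j, hj, h⟩ := h
        refine ⟨j, hj, hn.1, le_antisymm ?_ h⟩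
        have h1 := ((digitPrefix_le_and_lt hfin n L j).1.trans (hn.2 j hj)).trans_lt (hc1 j)
        rw [div_lt_div_iff_of_pos_right (by positivity)] at h1
        have : digitPrefix (C j) n L < c j + 1 := by exact_mod_cast h1
        omega
    · exact (Finset.card_union_le _ _).trans (Nat.add_le_add_left Finset.card_biUnion_le _)
  have hslab : ∑ j ∈ u, (((Finset.range M).filter
      (fun n => digitPrefix (C j) n L = c j)).card : ℝ) ≤ u.card * (1 + 2 ^ t) := by
    rw [← nsmul_eq_mul]
    exact Finset.sum_le_card_nsmul _ _ _ fun j _ => card_slab_le hnet L M hM j (c j)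
  have hvol : M * |∏ j ∈ u, x j - ∏ j ∈ u, ((c j : ℝ) / 2 ^ L)| ≤ u.card := by
    have h1 := abs_prod_sub_prod_le u x (fun j => (c j : ℝ) / 2 ^ L) (fun j _ => hx j)
      (fun j _ => ⟨by positivity, (hc0 j).trans (hx j).2⟩)
    have h2 : ∑ j ∈ u, |x j - (c j : ℝ) / 2 ^ L| ≤ u.card * (1 / 2 ^ L) := by
      rw [← nsmul_eq_mul]
      refine Finset.sum_le_card_nsmul _ _ _ fun j _ => ?_
      rw [abs_of_nonneg (sub_nonneg.2 (hc0 j))]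
      have := hc1 j
      rw [add_div] at this
      linarith
    have h3 : (M : ℝ) * (1 / 2 ^ L) ≤ 1 := by
      rw [mul_one_div, div_le_one (by positivity)]
      exact_mod_cast hM
    calc _ ≤ M * (u.card * (1 / 2 ^ L : ℝ)) := by gcongr; exact h1.trans h2
      _ = u.card * (M * (1 / 2 ^ L : ℝ)) := by ring
      _ ≤ u.card * 1 := by gcongr
      _ = _ := mul_one _
  have hmain : |(((Finset.range M).filter P).card : ℝ) - M * ∏ j ∈ u, x j|
      ≤ 2 ^ t * (L : ℝ) ^ u.card + u.card * (1 + 2 ^ t) + u.card := by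
    have hlo' : (((Finset.range M).filter P').card : ℝ) ≤ ((Finset.range M).filter P).card := by
      exact_mod_cast hlo
    have hhi' : (((Finset.range M).filter P).card : ℝ) ≤ ((Finset.range M).filter P').card
        + ∑ j ∈ u, (((Finset.range M).filter (fun n => digitPrefix (C j) n L = c j)).card : ℝ) := by
      exact_mod_cast hhi
    have hv : |(M : ℝ) * ∏ j ∈ u, x j - M * ∏ j ∈ u, ((c j : ℝ) / 2 ^ L)| ≤ u.card := by
      rw [← mul_sub, abs_mul, Nat.abs_cast]
      exact hvol
    rw [abs_le] at hdy hv ⊢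
    have h0 : (0 : ℝ) ≤ u.card * (1 + 2 ^ t) := by positivity
    constructor <;> linarith
  have hL3 : (L : ℝ) ≤ 3 * Real.log N := clog_le_three_mul_log hN
  have hlog2 := Real.log_two_gt_d9
  have hlogN : Real.log 2 ≤ Real.log N :=
    Real.log_le_log (by norm_num) (by exact_mod_cast hN)
  have hlog : 1 ≤ Real.log (2 * N) := by
    rw [Real.log_mul (by norm_num) (by positivity)]
    linarith
  set W := (3 * Real.log N) ^ u.card with hW
  have hLW : (L : ℝ) ^ u.card ≤ W := by rw [hW]; gcongr
  -- Uses `|u| ≤ 2 ^ |u|` and `2 ≤ 3 log 2`.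
  have huW : (u.card : ℝ) ≤ W := by
    have h1 : (u.card : ℝ) ≤ 2 ^ u.card := by exact_mod_cast (Nat.lt_two_pow_self).le
    refine h1.trans ?_
    rw [hW]
    gcongr
    linarith
  have hW0 : 0 ≤ W := (Nat.cast_nonneg _).trans huW
  have ht : (1 : ℝ) ≤ 2 ^ t := one_le_pow₀ (by norm_num)
  -- The dyadic box costs one `2 ^ t * W`, the slabs two and the change of volume one. The constant
  -- `5` and the factor `log (2 N) ≥ 1` are slack.
  calc _ ≤ _ := hmain
    _ ≤ 2 ^ t * W + W * (2 ^ t + 2 ^ t) + W * 2 ^ t := by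
      gcongr
      nlinarith
    _ = 4 * 2 ^ t * W := by ring
    _ ≤ 5 * 2 ^ t * W := by gcongr; norm_num
    _ ≤ 5 * 2 ^ t * W * Real.log (2 * N) := le_mul_of_one_le_right (by positivity) hlog
    _ = _ := by ring

end MixtureQMC

namespace MixtureQMC

/-! ### A Koksma-Hlawka inequality for pairs of measures -/

open MeasureTheory

/-- The point with the coordinates of `x` below `k` and those of `w` from `k` on. -/
def splice {s : ℕ} (k : ℕ) (x w : Fin s → ℝ) : Fin s → ℝ := fun i => if i.val < k then x i else w i

lemma update_splice_succ {s : ℕ} (j : Fin s) (x w : Fin s → ℝ) (t : ℝ) :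
    Function.update (splice (j.val + 1) x w) j t = splice j.val x (Function.update w j t) := by
  ext i
  by_cases hij : i = j
  · subst hij; simp [splice]
  · have : i.val ≠ j.val := fun h => hij (Fin.ext h)
    simp only [splice, Function.update_of_ne hij]
    congr 1
    simp only [eq_iff_iff]
    omega

lemma measurable_splice_update {s : ℕ} (k : ℕ) (j : Fin s) (w : Fin s → ℝ) :
    Measurable (fun z : (Fin s → ℝ) × ℝ => splice k z.1 (Function.update w j z.2)) := by
  rw [measurable_pi_iff]
  intro i
  by_cases hik : i.val < k
  · simp only [splice, if_pos hik]
    fun_prop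
  · simp only [splice, if_neg hik]
    by_cases hij : i = j
    · subst hij; simp only [Function.update_self]; fun_prop
    · simp only [Function.update_of_ne hij]; fun_prop

lemma measurable_splice {s : ℕ} (k : ℕ) (w : Fin s → ℝ) :
    Measurable (fun x : Fin s → ℝ => splice k x w) := by
  rw [measurable_pi_iff]
  intro i
  by_cases hik : i.val < k
  · simp only [splice, if_pos hik]; fun_prop
  · simp only [splice, if_neg hik]; fun_prop

variable {s : ℕ} {a b : Fin s → ℝ} {F : Finset (Fin s) → (Fin s → ℝ) → ℝ} {S : Finset (Fin s) → ℝ}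

lemma integrable_of_abs_le {α : Type*} [MeasurableSpace α] (μ : Measure α) [IsFiniteMeasure μ]
    {g : α → ℝ} (hg : Measurable g) {K : ℝ} (hK : ∀ x, |g x| ≤ K) : Integrable g μ :=
  Integrable.of_bound hg.aestronglyMeasurable K (Filter.Eventually.of_forall hK)

/-- The hypothesis of Fubini's theorem: the indicator of `x j ≤ t` makes the variable limit of
integration a jointly measurable region. -/
lemma integrable_indicator_splice (hmeas : ∀ u, Measurable (F u)) (hbd : ∀ u x, |F u x| ≤ S u)
    (j : Fin s) (u : Finset (Fin s)) (w : Fin s → ℝ) (μ : Measure (Fin s → ℝ))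
    [IsFiniteMeasure μ] (ρ : Measure ℝ) [IsFiniteMeasure ρ] :
    Integrable (Function.uncurry fun (x : Fin s → ℝ) (t : ℝ) =>
      (Set.Ici (x j)).indicator (fun t => F u (splice j.val x (Function.update w j t))) t)
      (μ.prod ρ) := by
  have hset : MeasurableSet {z : (Fin s → ℝ) × ℝ | z.1 j ≤ z.2} :=
    measurableSet_le (by fun_prop) (by fun_prop)
  have heq : (Function.uncurry fun (x : Fin s → ℝ) (t : ℝ) =>
      (Set.Ici (x j)).indicator (fun t => F u (splice j.val x (Function.update w j t))) t)
      = {z : (Fin s → ℝ) × ℝ | z.1 j ≤ z.2}.indicator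
        (fun z => F u (splice j.val z.1 (Function.update w j z.2))) := by
    ext ⟨x, t⟩
    simp [Function.uncurry, Set.indicator]
  rw [heq]
  exact (integrable_of_abs_le _ ((hmeas u).comp (measurable_splice_update _ _ _))
    (fun z => hbd u _)).indicator hset

lemma integral_indicator_Ici (j : Fin s) (g : (Fin s → ℝ) → ℝ → ℝ) (μ : Measure (Fin s → ℝ))
    (t : ℝ) : ∫ x, (Set.Ici (x j)).indicator (g x) t ∂μ = ∫ x in {x | x j ≤ t}, g x t ∂μ := by
  rw [← integral_indicator (measurableSet_le (by fun_prop) (by fun_prop))]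
  refine integral_congr_ae (Filter.Eventually.of_forall fun x => ?_)
  simp [Set.indicator]

/-- Expansion of the integral of `F u` in the coordinate `j`. -/
lemma integral_splice_succ (hmeas : ∀ u, Measurable (F u)) (hbd : ∀ u x, |F u x| ≤ S u)
    (hftc : ∀ (u : Finset (Fin s)) (j : Fin s), (∀ i ∈ u, j < i) → ∀ x : Fin s → ℝ,
      x j ∈ Set.Icc (a j) (b j) → F u x = F u (Function.update x j (b j))
        - ∫ t in (x j)..(b j), F (insert j u) (Function.update x j t))
    (j : Fin s) (u : Finset (Fin s)) (hu : ∀ i ∈ u, j < i) (w : Fin s → ℝ)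
    (μ : Measure (Fin s → ℝ)) [IsFiniteMeasure μ] (hμ : ∀ᵐ x ∂μ, x ∈ Set.Icc a b) :
    ∫ x, F u (splice (j.val + 1) x w) ∂μ
      = ∫ x, F u (splice j.val x (Function.update w j (b j))) ∂μ
        - ∫ t in Set.Icc (a j) (b j), ∫ x in {x | x j ≤ t},
            F (insert j u) (splice j.val x (Function.update w j t)) ∂μ := by
  have hint := integrable_indicator_splice hmeas hbd j (insert j u) w μ
    (volume.restrict (Set.Icc (a j) (b j)))
  have hleft := hint.integral_prod_left
  simp only [Function.uncurry_apply_pair] at hleft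
  have h1 : ∀ᵐ x ∂μ, F u (splice (j.val + 1) x w)
      = F u (splice j.val x (Function.update w j (b j)))
        - ∫ t in Set.Icc (a j) (b j), (Set.Ici (x j)).indicator
            (fun t => F (insert j u) (splice j.val x (Function.update w j t))) t := by
    filter_upwards [hμ] with x hx
    have hxj : splice (j.val + 1) x w j = x j := by simp [splice]
    have := hftc u j hu (splice (j.val + 1) x w) (by rw [hxj]; exact ⟨hx.1 j, hx.2 j⟩)
    simp only [update_splice_succ, hxj] at this
    rw [this, setIntegral_indicator measurableSet_Ici, intervalIntegral.integral_of_le (hx.2 j),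
      ← integral_Icc_eq_integral_Ioc]
    congr 3
    ext t
    have := hx.1 j
    simp only [Set.mem_Icc, Set.mem_inter_iff, Set.mem_Ici]
    constructor
    · rintro ⟨h1, h2⟩; exact ⟨⟨this.trans h1, h2⟩, h1⟩
    · rintro ⟨⟨_, h2⟩, h1⟩; exact ⟨h1, h2⟩
  -- After the swap, the condition `x j ≤ t` restricts the measure in `x`, where it was a limit of
  -- integration in `t`.
  rw [integral_congr_ae h1, integral_sub _ hleft, integral_integral_swap hint]
  · congr 1
    refine integral_congr_ae (Filter.Eventually.of_forall fun t => ?_)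
    exact integral_indicator_Ici j _ μ t
  · exact integrable_of_abs_le μ ((hmeas u).comp (measurable_splice _ _)) (fun x => hbd u _)

lemma integrable_inner_integral (hmeas : ∀ u, Measurable (F u)) (hbd : ∀ u x, |F u x| ≤ S u)
    (j : Fin s) (u : Finset (Fin s)) (w : Fin s → ℝ) (μ : Measure (Fin s → ℝ))
    [IsFiniteMeasure μ] (ρ : Measure ℝ) [IsFiniteMeasure ρ] :
    Integrable (fun t => ∫ x in {x | x j ≤ t}, F u (splice j.val x (Function.update w j t)) ∂μ)
      ρ := by
  refine (integrable_indicator_splice hmeas hbd j u w μ ρ).integral_prod_right.congr ?_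
  exact Filter.Eventually.of_forall fun t => integral_indicator_Ici j
    (fun x t => F u (splice j.val x (Function.update w j t))) μ t

lemma measurableSet_forall_le (u : Finset (Fin s)) (z : Fin s → ℝ) :
    MeasurableSet {x : Fin s → ℝ | ∀ i ∈ u, x i ≤ z i} := by
  have : {x : Fin s → ℝ | ∀ i ∈ u, x i ≤ z i} = ⋂ i ∈ u, {x | x i ≤ z i} := by ext; simp
  rw [this]
  exact Finset.measurableSet_biInter _ fun i _ => measurableSet_le (by fun_prop) (by fun_prop)

/-- This closes the induction below: a box for the measure restricted to `x j ≤ t` is a box of the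
original measure with one more constrained coordinate. -/
lemma real_restrict_forall_le (μ : Measure (Fin s → ℝ)) (j : Fin s) (u : Finset (Fin s))
    (hj : j ∉ u) (z : Fin s → ℝ) (t : ℝ) :
    (μ.restrict {x | x j ≤ t}).real {x | ∀ i ∈ u, x i ≤ z i}
      = μ.real {x | ∀ i ∈ insert j u, x i ≤ Function.update z j t i} := by
  rw [measureReal_restrict_apply (measurableSet_forall_le u z)]
  congr 1
  ext x
  simp only [Set.mem_inter_iff, Set.mem_ofPred_eq, Finset.forall_mem_insert, Function.update_self]
  rw [and_comm]
  refine and_congr_right fun _ => forall₂_congr fun i hi => ?_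
  rw [Function.update_of_ne (ne_of_mem_of_not_mem hi hj)]

/-- Induction on the number `k` of free coordinates, removing the largest first so that each new
differentiation index lies below those in `u₀`. By the fundamental theorem of calculus, coordinate
`k` is either frozen at its right endpoint or differentiated and integrated over `t`. In the second
case the measures are replaced by restrictions, so the claim must cover all finite measures, all
frozen values `w` and all bounds `D`. -/
lemma abs_integral_splice_sub_le (hab : ∀ j, a j < b j) (hmeas : ∀ u, Measurable (F u))
    (hbd : ∀ u x, |F u x| ≤ S u)
    (hftc : ∀ (u : Finset (Fin s)) (j : Fin s), (∀ i ∈ u, j < i) → ∀ x : Fin s → ℝ,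
      x j ∈ Set.Icc (a j) (b j) → F u x = F u (Function.update x j (b j))
        - ∫ t in (x j)..(b j), F (insert j u) (Function.update x j t))
    (k : ℕ) (hk : k ≤ s) : ∀ (u₀ : Finset (Fin s)), (∀ i ∈ u₀, k ≤ i.val) → ∀ (w : Fin s → ℝ)
    (μ ν : Measure (Fin s → ℝ)) [IsFiniteMeasure μ] [IsFiniteMeasure ν],
    (∀ᵐ x ∂μ, x ∈ Set.Icc a b) → (∀ᵐ x ∂ν, x ∈ Set.Icc a b) → ∀ D : Finset (Fin s) → ℝ,
    (∀ u : Finset (Fin s), (∀ i ∈ u, i.val < k) → ∀ z ∈ Set.Icc a b,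
      |μ.real {x | ∀ i ∈ u, x i ≤ z i} - ν.real {x | ∀ i ∈ u, x i ≤ z i}| ≤ D u) →
    |∫ x, F u₀ (splice k x w) ∂μ - ∫ x, F u₀ (splice k x w) ∂ν|
      ≤ ∑ u ∈ (Finset.univ.filter fun i : Fin s => i.val < k).powerset,
          (∏ j ∈ u, (b j - a j)) * S (u ∪ u₀) * D u := by
  induction k with
  | zero =>
    intro u₀ _ w μ ν _ _ _ _ D hD
    -- With no free coordinate the integrands are constant and only the difference of the total
    -- masses remains; the corner `a` is arbitrary.
    have h := hD ∅ (by simp) a ⟨le_rfl, fun j => (hab j).le⟩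
    simp only [Finset.notMem_empty, IsEmpty.forall_iff, implies_true, Set.ofPred_true] at h
    have hw : ∀ x, splice 0 x w = w := fun x => by ext; simp [splice]
    simp only [hw, integral_const, smul_eq_mul, not_lt_zero, Finset.filter_false,
      Finset.powerset_empty, Finset.sum_singleton, Finset.prod_empty, one_mul, Finset.empty_union]
    rw [← sub_mul, abs_mul, mul_comm]
    exact mul_le_mul (hbd _ _) h (abs_nonneg _) ((abs_nonneg _).trans (hbd u₀ w))
  | succ k ih =>
    intro u₀ hu₀ w μ ν _ _ hμ hν D hD
    have ih := ih (by omega)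
    let j : Fin s := ⟨k, by omega⟩
    have hu₀' : ∀ i ∈ u₀, j < i := fun i hi => Fin.lt_def.2 (hu₀ i hi)
    have eμ := integral_splice_succ hmeas hbd hftc j u₀ hu₀' w μ hμ
    have eν := integral_splice_succ hmeas hbd hftc j u₀ hu₀' w ν hν
    have iμ := integrable_inner_integral hmeas hbd j (insert j u₀) w μ
      (volume.restrict (Set.Icc (a j) (b j)))
    have iν := integrable_inner_integral hmeas hbd j (insert j u₀) w ν
      (volume.restrict (Set.Icc (a j) (b j)))
    have h1 := ih u₀ (fun i hi => (Nat.le_succ k).trans (hu₀ i hi)) (Function.update w j (b j)) μ ν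
      hμ hν D (fun u hu z hz => hD u (fun i hi => (hu i hi).trans (Nat.lt_succ_self k)) z hz)
    have hjk : ∀ u : Finset (Fin s), (∀ i ∈ u, i.val < k) → j ∉ u := fun u hu hj => by
      have := hu j hj
      simp [j] at this
    have h2 : ∀ t ∈ Set.Icc (a j) (b j),
        ‖(∫ x in {x | x j ≤ t}, F (insert j u₀) (splice j.val x (Function.update w j t)) ∂μ)
          - ∫ x in {x | x j ≤ t}, F (insert j u₀) (splice j.val x (Function.update w j t)) ∂ν‖
        ≤ ∑ u ∈ (Finset.univ.filter fun i : Fin s => i.val < k).powerset,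
          (∏ j ∈ u, (b j - a j)) * S (u ∪ insert j u₀) * D (insert j u) := by
      intro t ht
      refine ih (insert j u₀) ?_ (Function.update w j t) (μ.restrict {x | x j ≤ t})
        (ν.restrict {x | x j ≤ t}) (ae_restrict_of_ae hμ) (ae_restrict_of_ae hν)
        (fun u => D (insert j u)) ?_
      · intro i hi
        rcases Finset.mem_insert.1 hi with rfl | hi
        · exact le_rfl
        · exact (Nat.le_succ k).trans (hu₀ i hi)
      · intro u hu z hz
        rw [real_restrict_forall_le μ j u (hjk u hu), real_restrict_forall_le ν j u (hjk u hu)]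
        refine hD (insert j u) ?_ _ ?_
        · intro i hi
          rcases Finset.mem_insert.1 hi with rfl | hi
          · exact Nat.lt_succ_self k
          · exact (hu i hi).trans (Nat.lt_succ_self k)
        · constructor
          · intro i
            by_cases hij : i = j
            · subst hij; simpa using ht.1
            · simpa [hij] using hz.1 i
          · intro i
            by_cases hij : i = j
            · subst hij; simpa using ht.2
            · simpa [hij] using hz.2 i
    have h3 := norm_setIntegral_le_of_norm_le_const (μ := volume)
      (s := Set.Icc (a j) (b j)) measure_Icc_lt_top h2
    rw [integral_sub iμ iν, Real.norm_eq_abs, Real.volume_real_Icc_of_le (hab j).le] at h3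
    have hins : (Finset.univ.filter fun i : Fin s => i.val < k + 1)
        = insert j (Finset.univ.filter fun i : Fin s => i.val < k) := by
      ext i
      simp only [Finset.mem_filter, Finset.mem_univ, true_and, Finset.mem_insert, j, Fin.ext_iff]
      omega
    -- Subsets without `j` come from freezing the coordinate, those containing `j` from
    -- differentiating in it.
    rw [hins, Finset.sum_powerset_insert (hjk _ (by simp))]
    have h4 : (∑ u ∈ (Finset.univ.filter fun i : Fin s => i.val < k).powerset,
          (∏ j ∈ u, (b j - a j)) * S (u ∪ insert j u₀) * D (insert j u)) * (b j - a j)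
        = ∑ u ∈ (Finset.univ.filter fun i : Fin s => i.val < k).powerset,
          (∏ j ∈ insert j u, (b j - a j)) * S (insert j u ∪ u₀) * D (insert j u) := by
      rw [Finset.sum_mul]
      refine Finset.sum_congr rfl fun u hu => ?_
      have hju : j ∉ u := hjk u fun i hi => by simpa using Finset.mem_powerset.1 hu hi
      rw [Finset.prod_insert hju, Finset.union_insert, Finset.insert_union]
      ring
    rw [h4] at h3
    change |∫ x, F u₀ (splice (j.val + 1) x w) ∂μ - ∫ x, F u₀ (splice (j.val + 1) x w) ∂ν| ≤ _
    rw [eμ, eν]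
    change |∫ x, F u₀ (splice j.val x (Function.update w j (b j))) ∂μ
      - ∫ x, F u₀ (splice j.val x (Function.update w j (b j))) ∂ν| ≤ _ at h1
    refine le_trans ?_ (add_le_add h1 h3)
    rw [sub_sub_sub_comm]
    exact abs_sub _ _

/-- A Koksma-Hlawka inequality: two finite measures on a box that almost agree on anchored boxes
almost agree on functions with bounded mixed derivatives. -/
theorem abs_integral_sub_le (hab : ∀ j, a j < b j) (hmeas : ∀ u, Measurable (F u))
    (hbd : ∀ u x, |F u x| ≤ S u)
    (hftc : ∀ (u : Finset (Fin s)) (j : Fin s), (∀ i ∈ u, j < i) → ∀ x : Fin s → ℝ,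
      x j ∈ Set.Icc (a j) (b j) → F u x = F u (Function.update x j (b j))
        - ∫ t in (x j)..(b j), F (insert j u) (Function.update x j t))
    (μ ν : Measure (Fin s → ℝ)) [IsFiniteMeasure μ] [IsFiniteMeasure ν]
    (hμ : ∀ᵐ x ∂μ, x ∈ Set.Icc a b) (hν : ∀ᵐ x ∂ν, x ∈ Set.Icc a b) (D : Finset (Fin s) → ℝ)
    (hD : ∀ u : Finset (Fin s), ∀ z ∈ Set.Icc a b,
      |μ.real {x | ∀ i ∈ u, x i ≤ z i} - ν.real {x | ∀ i ∈ u, x i ≤ z i}| ≤ D u) :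
    |∫ x, F ∅ x ∂μ - ∫ x, F ∅ x ∂ν| ≤ ∑ u, (∏ j ∈ u, (b j - a j)) * S u * D u := by
  have h := abs_integral_splice_sub_le hab hmeas hbd hftc s le_rfl ∅ (by simp) a μ ν hμ hν D
    (fun u _ z hz => hD u z hz)
  have hs : ∀ x, splice s x a = x := fun x => by ext i; simp [splice]
  simpa [hs] using h

end MixtureQMC

namespace MixtureQMC

/-! ### Mixed partial derivatives extended to the whole space -/

open MeasureTheory

variable {s : ℕ} {a b : Fin s → ℝ} {f : (Fin s → ℝ) → ℝ}

/-- The nearest point of the box `[a, b]`. -/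
def clampBox (a b x : Fin s → ℝ) : Fin s → ℝ := fun j => max (a j) (min (b j) (x j))

lemma clampBox_mem (hab : ∀ j, a j < b j) (x : Fin s → ℝ) : clampBox a b x ∈ Set.Icc a b :=
  ⟨fun _ => le_max_left _ _, fun j => max_le (hab j).le (min_le_left _ _)⟩

lemma clampBox_of_mem {x : Fin s → ℝ} (hx : x ∈ Set.Icc a b) : clampBox a b x = x := by
  ext j
  simp [clampBox, min_eq_right (hx.2 j), max_eq_right (hx.1 j)]

lemma measurable_clampBox : Measurable (clampBox a b) := by
  unfold clampBox
  fun_prop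

lemma continuous_clampBox : Continuous (clampBox a b) := by
  unfold clampBox
  fun_prop

lemma clampBox_update (x : Fin s → ℝ) (j : Fin s) {y : ℝ} (hy : y ∈ Set.Icc (a j) (b j)) :
    clampBox a b (Function.update x j y) = Function.update (clampBox a b x) j y := by
  ext i
  by_cases hij : i = j
  · subst hij
    simp [clampBox, min_eq_right hy.2, max_eq_right hy.1]
  · simp [clampBox, hij]

lemma update_mem_box {x : Fin s → ℝ} (hx : x ∈ Set.Icc a b) (j : Fin s) {y : ℝ}
    (hy : y ∈ Set.Icc (a j) (b j)) : Function.update x j y ∈ Set.Icc a b := by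
  constructor <;> intro i <;> by_cases hij : i = j
  · subst hij; simpa using hy.1
  · simpa [hij] using hx.1 i
  · subst hij; simpa using hy.2
  · simpa [hij] using hx.2 i

lemma mixedPartial_empty : mixedPartial a b ∅ f = f := by simp [mixedPartial]

lemma mixedPartial_insert (u : Finset (Fin s)) (j : Fin s) (hj : ∀ i ∈ u, j < i) :
    mixedPartial a b (insert j u) f = partialDeriv a b j (mixedPartial a b u f) := by
  unfold mixedPartial
  rw [Finset.sort_insert _ (fun i hi => (hj i hi).le) fun h => lt_irrefl j (hj j h)]
  rfl

/-- The mixed partial derivative, extended constantly outside of the box. -/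
noncomputable def extendedPartial (a b : Fin s → ℝ) (f : (Fin s → ℝ) → ℝ) (u : Finset (Fin s))
    (x : Fin s → ℝ) : ℝ := mixedPartial a b u f (clampBox a b x)

lemma hasDerivWithinAt_extendedPartial (hab : ∀ j, a j < b j) (hf : HasMixedPartials a b f)
    (u : Finset (Fin s)) (j : Fin s) (hj : ∀ i ∈ u, j < i) (x : Fin s → ℝ) {y : ℝ}
    (hy : y ∈ Set.Icc (a j) (b j)) :
    HasDerivWithinAt (fun y => extendedPartial a b f u (Function.update x j y))
      (extendedPartial a b f (insert j u) (Function.update x j y)) (Set.Icc (a j) (b j)) y := by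
  have h := (hf u j hj (clampBox a b (Function.update x j y))
    (clampBox_mem hab _)).hasDerivWithinAt
  have hval : extendedPartial a b f (insert j u) (Function.update x j y)
      = derivWithin (fun z => mixedPartial a b u f
          (Function.update (clampBox a b (Function.update x j y)) j z)) (Set.Icc (a j) (b j))
          (clampBox a b (Function.update x j y) j) := by
    rw [extendedPartial, mixedPartial_insert u j hj]
    rfl
  rw [← hval] at h
  rw [clampBox_update x j hy] at h
  simp only [Function.update_self, Function.update_idem] at h
  refine h.congr (fun z hz => ?_) ?_
  · rw [extendedPartial, clampBox_update x j hz]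
  · rw [extendedPartial, clampBox_update x j hy]

/-- A function with bounded first order partial derivatives on a box is continuous there. -/
lemma continuous_extendedPartial_empty (hab : ∀ j, a j < b j) (hf : HasMixedPartials a b f)
    {S : Finset (Fin s) → ℝ} (hbd : ∀ u x, |extendedPartial a b f u x| ≤ S u) :
    Continuous (extendedPartial a b f ∅) := by
  have h1 : ∀ (j : Fin s) (x : Fin s → ℝ), ∀ y ∈ Set.Icc (a j) (b j), ∀ z ∈ Set.Icc (a j) (b j),
      |extendedPartial a b f ∅ (Function.update x j z)
        - extendedPartial a b f ∅ (Function.update x j y)| ≤ S {j} * |z - y| := by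
    intro j x y hy z hz
    refine (convex_Icc (a j) (b j)).norm_image_sub_le_of_norm_hasDerivWithin_le
      (f := fun y => extendedPartial a b f ∅ (Function.update x j y))
      (fun t ht => hasDerivWithinAt_extendedPartial hab hf ∅ j (by simp) x ht)
      (fun t _ => ?_) hy hz
    simpa using hbd (insert j ∅) (Function.update x j t)
  -- Passing from `x` to `y` one coordinate at a time stays in the box, so the one-dimensional mean
  -- value bounds add up.
  have h2 : ∀ (v : Finset (Fin s)), ∀ x ∈ Set.Icc a b, ∀ y ∈ Set.Icc a b,
      v.piecewise y x ∈ Set.Icc a b ∧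
      |extendedPartial a b f ∅ (v.piecewise y x) - extendedPartial a b f ∅ x|
        ≤ ∑ j ∈ v, S {j} * |y j - x j| := by
    intro v x hx y hy
    induction v using Finset.induction_on with
    | empty => simpa using hx
    | insert j v hj ih =>
      rw [Finset.piecewise_insert, Finset.sum_insert hj]
      refine ⟨update_mem_box ih.1 j ⟨hy.1 j, hy.2 j⟩, ?_⟩
      have h := h1 j (v.piecewise y x) (x j) ⟨hx.1 j, hx.2 j⟩ (y j) ⟨hy.1 j, hy.2 j⟩
      have hu : Function.update (v.piecewise y x) j (x j) = v.piecewise y x := by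
        rw [Function.update_eq_self_iff]
        simp [hj]
      rw [hu] at h
      refine (abs_sub_le _ (extendedPartial a b f ∅ (v.piecewise y x)) _).trans ?_
      exact add_le_add h ih.2
  have h3 : ∀ x y, |extendedPartial a b f ∅ y - extendedPartial a b f ∅ x|
      ≤ ∑ j, S {j} * |clampBox a b y j - clampBox a b x j| := by
    intro x y
    have h := (h2 Finset.univ _ (clampBox_mem hab x) _ (clampBox_mem hab y)).2
    have hid : ∀ x, extendedPartial a b f ∅ (clampBox a b x) = extendedPartial a b f ∅ x :=
      fun x => by rw [extendedPartial, clampBox_of_mem (clampBox_mem hab x), extendedPartial]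
    simpa [hid] using h
  rw [continuous_iff_continuousAt]
  intro x
  rw [ContinuousAt, tendsto_iff_dist_tendsto_zero]
  refine squeeze_zero (fun _ => dist_nonneg) (fun y => h3 x y) ?_
  have hc : Continuous fun y => ∑ j, S {j} * |clampBox a b y j - clampBox a b x j| := by
    have := continuous_clampBox (a := a) (b := b)
    fun_prop
  have := hc.tendsto x
  simpa using this

/-- A derivative that exists everywhere is a pointwise limit of difference quotients, hence
measurable; no continuity of the derivative is needed. -/
lemma measurable_extendedPartial_insert (hab : ∀ j, a j < b j) (hf : HasMixedPartials a b f)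
    (u : Finset (Fin s)) (j : Fin s) (hj : ∀ i ∈ u, j < i)
    (hu : Measurable (extendedPartial a b f u)) :
    Measurable (extendedPartial a b f (insert j u)) := by
  -- An endpoint different from `y`: steps towards it are nonzero and remain in the interval, also
  -- when `y` is on a face of the box.
  let c : ℝ → ℝ := fun y => if y < b j then b j else a j
  have hc : Measurable c := Measurable.ite measurableSet_Iio measurable_const measurable_const
  let p : (Fin s → ℝ) → ℝ := fun x => clampBox a b x j
  have hp : Measurable p := (measurable_pi_apply j).comp measurable_clampBox
  have hpI : ∀ x, p x ∈ Set.Icc (a j) (b j) := fun x =>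
    ⟨(clampBox_mem hab x).1 j, (clampBox_mem hab x).2 j⟩
  let y : ℕ → (Fin s → ℝ) → ℝ := fun n x => p x + (c (p x) - p x) * (1 / ((n : ℝ) + 1))
  have hy : ∀ n, Measurable (y n) := fun n =>
    hp.add (((hc.comp hp).sub hp).mul_const _)
  have hcI : ∀ x, c (p x) ∈ Set.Icc (a j) (b j) := fun x => by
    simp only [c]
    split_ifs
    · exact ⟨(hab j).le, le_rfl⟩
    · exact ⟨le_rfl, (hab j).le⟩
  have hcne : ∀ x, c (p x) - p x ≠ 0 := fun x => by
    simp only [c]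
    split_ifs with h
    · linarith
    · have := hab j; push Not at h; intro h'; linarith
  have hyI : ∀ n x, y n x ∈ Set.Icc (a j) (b j) := fun n x => by
    have h1 : 1 / ((n : ℝ) + 1) ≤ 1 := by
      rw [div_le_one (by positivity)]; linarith [n.cast_nonneg (α := ℝ)]
    have h := (convex_Icc (a j) (b j)).add_smul_sub_mem (hpI x) (hcI x)
      (t := 1 / ((n : ℝ) + 1)) ⟨by positivity, h1⟩
    simpa [y, mul_comm] using h
  have hupd : ∀ g : (Fin s → ℝ) → ℝ, Measurable g →
      Measurable fun x => extendedPartial a b f u (Function.update x j (g x)) := by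
    intro g hg
    refine hu.comp (measurable_pi_iff.2 fun i => ?_)
    by_cases hij : i = j
    · subst hij; simpa using hg
    · simpa [hij] using measurable_pi_apply i
  refine measurable_of_tendsto_metrizable (f := fun n x => (y n x - p x)⁻¹ *
    (extendedPartial a b f u (Function.update x j (y n x))
      - extendedPartial a b f u (Function.update x j (p x))))
    (fun n => (((hy n).sub hp).inv).mul ((hupd _ (hy n)).sub (hupd _ hp))) ?_
  rw [tendsto_pi_nhds]
  intro x
  have hd := hasDerivWithinAt_extendedPartial hab hf u j hj x (hpI x)
  have hx : extendedPartial a b f (insert j u) (Function.update x j (p x))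
      = extendedPartial a b f (insert j u) x := by
    rw [extendedPartial, clampBox_update x j (hpI x), extendedPartial]
    congr 1
    exact Function.update_eq_self _ _
  rw [hx, hasDerivWithinAt_iff_tendsto_slope] at hd
  have hlim : Filter.Tendsto (fun n => y n x) Filter.atTop
      (nhdsWithin (p x) (Set.Icc (a j) (b j) \ {p x})) := by
    refine tendsto_nhdsWithin_iff.2 ⟨?_, Filter.Eventually.of_forall fun n => ⟨hyI n x, ?_⟩⟩
    · have := (tendsto_one_div_add_atTop_nhds_zero_nat (𝕜 := ℝ)).const_mul (c (p x) - p x)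
      simpa [y] using this.const_add (p x)
    · intro h
      have h' : (c (p x) - p x) * (1 / ((n : ℝ) + 1)) = 0 := by
        simpa [y] using (h : y n x = p x)
      rcases mul_eq_zero.1 h' with h' | h'
      · exact hcne x h'
      · exact absurd h' (by positivity)
  exact hd.comp hlim

lemma measurable_extendedPartial (hab : ∀ j, a j < b j) (hf : HasMixedPartials a b f)
    {S : Finset (Fin s) → ℝ} (hbd : ∀ u x, |extendedPartial a b f u x| ≤ S u)
    (u : Finset (Fin s)) : Measurable (extendedPartial a b f u) := by
  induction u using Finset.induction_on_min with
  | empty => exact (continuous_extendedPartial_empty hab hf hbd).measurable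
  | insert j u hj ih => exact measurable_extendedPartial_insert hab hf u j hj ih

/-- The form of the fundamental theorem of calculus that needs a derivative everywhere in the
interior and its integrability, which follows here from measurability and boundedness. -/
lemma extendedPartial_eq_sub_integral (hab : ∀ j, a j < b j) (hf : HasMixedPartials a b f)
    {S : Finset (Fin s) → ℝ} (hbd : ∀ u x, |extendedPartial a b f u x| ≤ S u)
    (u : Finset (Fin s)) (j : Fin s) (hj : ∀ i ∈ u, j < i) (x : Fin s → ℝ)
    (hx : x j ∈ Set.Icc (a j) (b j)) :
    extendedPartial a b f u x = extendedPartial a b f u (Function.update x j (b j))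
      - ∫ t in (x j)..(b j), extendedPartial a b f (insert j u) (Function.update x j t) := by
  have hd := fun t (ht : t ∈ Set.Icc (a j) (b j)) =>
    hasDerivWithinAt_extendedPartial hab hf u j hj x ht
  have hsub : Set.Icc (x j) (b j) ⊆ Set.Icc (a j) (b j) := Set.Icc_subset_Icc_left hx.1
  have hint : IntervalIntegrable
      (fun t => extendedPartial a b f (insert j u) (Function.update x j t)) volume (x j) (b j) := by
    rw [intervalIntegrable_iff_integrableOn_Ioc_of_le hx.2]
    exact integrable_of_abs_le _ ((measurable_extendedPartial hab hf hbd _).comp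
      (measurable_update x)) fun t => hbd _ _
  rw [intervalIntegral.integral_eq_sub_of_hasDerivAt_of_le hx.2
    (fun t ht => ((hd t (hsub ht)).continuousWithinAt).mono hsub)
    (fun t ht => (hd t (hsub (Set.Ioo_subset_Icc_self ht))).hasDerivAt
      (Icc_mem_nhds (hx.1.trans_lt ht.1) ht.2)) hint]
  simp

end MixtureQMC

namespace MixtureQMC

/-! ### Quasi-Monte Carlo error of a single mixture component -/

open MeasureTheory

/-- Nonnegativity of the density gives monotonicity, and injectivity makes it strict, even though
the density may vanish at some points. -/
lemma cdf_strictMonoOn {a b : ℝ} {φ : ℝ → ℝ} (h0 : ∀ x ∈ Set.Icc a b, 0 ≤ φ x)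
    (hint : IntegrableOn φ (Set.Icc a b)) (hbij : Set.BijOn (cdf a φ) (Set.Icc a b) (Set.Icc 0 1)) :
    StrictMonoOn (cdf a φ) (Set.Icc a b) := by
  intro x hx y hy hxy
  refine lt_of_le_of_ne ?_ fun h => hxy.ne (hbij.injOn hx hy h)
  have hint' : ∀ {u v : ℝ}, a ≤ u → u ≤ v → v ≤ b → IntervalIntegrable φ volume u v :=
    fun {u v} h1 h2 h3 => (intervalIntegrable_iff_integrableOn_Icc_of_le h2).2
      (hint.mono_set (Set.Icc_subset_Icc h1 h3))
  have h1 : 0 ≤ ∫ t in x..y, φ t := intervalIntegral.integral_nonneg hxy.le fun t ht =>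
    h0 t ⟨hx.1.trans ht.1, ht.2.trans hy.2⟩
  have h2 := intervalIntegral.integral_add_adjacent_intervals
    (hint' le_rfl hx.1 hx.2) (hint' hx.1 hxy.le hy.2)
  unfold cdf
  linarith

lemma invCdf_mem_and_le_iff {a b : ℝ} {φ : ℝ → ℝ} (h0 : ∀ x ∈ Set.Icc a b, 0 ≤ φ x)
    (hint : IntegrableOn φ (Set.Icc a b)) (hbij : Set.BijOn (cdf a φ) (Set.Icc a b) (Set.Icc 0 1))
    {y : ℝ} (hy : y ∈ Set.Icc (0 : ℝ) 1) :
    invCdf a b φ y ∈ Set.Icc a b ∧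
      ∀ z ∈ Set.Icc a b, (invCdf a b φ y ≤ z ↔ y ≤ cdf a φ z) := by
  have hmem : y ∈ cdf a φ '' Set.Icc a b := hbij.surjOn hy
  have h1 : invCdf a b φ y ∈ Set.Icc a b := Function.invFunOn_mem hmem
  have h2 : cdf a φ (invCdf a b φ y) = y := Function.invFunOn_eq hmem
  refine ⟨h1, fun z hz => ?_⟩
  rw [← (cdf_strictMonoOn h0 hint hbij).le_iff_le h1 hz, h2]

lemma restrict_box_eq_pi {s : ℕ} (a b : Fin s → ℝ) :
    (volume : Measure (Fin s → ℝ)).restrict (Set.Icc a b)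
      = Measure.pi (fun j => volume.restrict (Set.Icc (a j) (b j))) := by
  rw [← Set.pi_univ_Icc, volume_pi, Measure.restrict_pi_pi]

/-- The probability measure on points `X 0, …, X (n - 1)` with equal weights. -/
noncomputable def empiricalMeasure {α : Type*} [MeasurableSpace α] (X : ℕ → α) (n : ℕ) :
    Measure α :=
  (n : ℝ≥0∞)⁻¹ • ∑ i ∈ Finset.range n, Measure.dirac (X i)

section empirical

variable {α : Type*} [MeasurableSpace α] (X : ℕ → α) {n : ℕ}

lemma isFiniteMeasure_empiricalMeasure (hn : 0 < n) : IsFiniteMeasure (empiricalMeasure X n) := by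
  unfold empiricalMeasure
  exact Measure.smul_finite _ (by simp [hn.ne'])

lemma integral_empiricalMeasure {g : α → ℝ} (hg : Measurable g) :
    ∫ x, g x ∂(empiricalMeasure X n) = 1 / n * ∑ i ∈ Finset.range n, g (X i) := by
  unfold empiricalMeasure
  rw [integral_smul_measure, integral_finsetSum_measure fun i _ =>
    integrable_dirac' hg.stronglyMeasurable (by simp)]
  simp [integral_dirac' _ _ hg.stronglyMeasurable]

lemma measureReal_empiricalMeasure {A : Set α} (hA : MeasurableSet A) [DecidablePred (· ∈ A)] :
    (empiricalMeasure X n).real A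
      = 1 / n * (((Finset.range n).filter fun i => X i ∈ A).card : ℝ) := by
  rw [← integral_indicator_one hA, integral_empiricalMeasure X (measurable_one.indicator hA),
    Finset.card_filter]
  push_cast
  congr 1
  refine Finset.sum_congr rfl fun i _ => ?_
  by_cases h : X i ∈ A <;> simp [h]

lemma ae_empiricalMeasure {p : α → Prop} (hp : MeasurableSet {x | p x}) (h : ∀ i, p (X i)) :
    ∀ᵐ x ∂(empiricalMeasure X n), p x := by
  have hcompl : {x | ¬ p x} = {x | p x}ᶜ := by ext; simp
  unfold empiricalMeasure
  refine Measure.ae_smul_measure ?_ _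
  rw [ae_iff, hcompl, Measure.finsetSum_apply]
  refine Finset.sum_eq_zero fun i _ => ?_
  rw [Measure.dirac_apply' _ hp.compl]
  simp [h i]

end empirical

/-! ### Distributions of the components and transport of the point set -/

namespace Mixture

variable {s : ℕ} {a b : Fin s → ℝ} (M : Mixture a b) (k : M.Index)

/-- The density of the component `k`. -/
noncomputable def density (x : Fin s → ℝ) : ℝ := ∏ j, M.φ j (k j) (x j)

lemma density_nonneg {x : Fin s → ℝ} (hx : x ∈ Set.Icc a b) : 0 ≤ M.density k x :=
  Finset.prod_nonneg fun j _ => M.φ_nonneg j (k j) (x j) ⟨hx.1 j, hx.2 j⟩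

lemma integrableOn_density : IntegrableOn (M.density k) (Set.Icc a b) := by
  unfold IntegrableOn
  rw [restrict_box_eq_pi]
  exact Integrable.fintype_prod fun j => M.φ_integrable j (k j)

/-- The distribution of the component `k`. -/
noncomputable def componentMeasure : Measure (Fin s → ℝ) :=
  (volume.restrict (Set.Icc a b)).withDensity fun x => ENNReal.ofReal (M.density k x)

instance : IsFiniteMeasure (M.componentMeasure k) :=
  isFiniteMeasure_withDensity_ofReal (M.integrableOn_density k).hasFiniteIntegral

lemma ae_componentMeasure : ∀ᵐ x ∂(M.componentMeasure k), x ∈ Set.Icc a b :=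
  (withDensity_absolutelyContinuous _ _).ae_le (ae_restrict_mem measurableSet_Icc)

lemma integral_componentMeasure (g : (Fin s → ℝ) → ℝ) :
    ∫ x, g x ∂(M.componentMeasure k) = ∫ x in Set.Icc a b, g x * M.density k x := by
  unfold componentMeasure
  rw [integral_withDensity_eq_integral_toReal_smul₀
    (M.integrableOn_density k).aestronglyMeasurable.aemeasurable.ennreal_ofReal
    (Filter.Eventually.of_forall fun _ => ENNReal.ofReal_lt_top)]
  refine setIntegral_congr_fun measurableSet_Icc fun x hx => ?_
  simp only [ENNReal.toReal_ofReal (M.density_nonneg k hx), smul_eq_mul]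
  ring

/-- Indicator and density are both products over coordinates, so the integral factors; each
coordinate outside `u` integrates to `1`. -/
lemma measureReal_componentMeasure_box (u : Finset (Fin s)) {z : Fin s → ℝ}
    (hz : z ∈ Set.Icc a b) :
    (M.componentMeasure k).real {x | ∀ i ∈ u, x i ≤ z i}
      = ∏ j ∈ u, cdf (a j) (M.φ j (k j)) (z j) := by
  classical
  rw [← integral_indicator_one (measurableSet_forall_le u z), integral_componentMeasure,
    restrict_box_eq_pi]
  have h1 : ∀ x : Fin s → ℝ, {x : Fin s → ℝ | ∀ i ∈ u, x i ≤ z i}.indicator 1 x * M.density k x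
      = ∏ j, (if j ∈ u then (Set.Iic (z j)).indicator (M.φ j (k j)) else M.φ j (k j)) (x j) := by
    intro x
    by_cases h : ∀ i ∈ u, x i ≤ z i
    · rw [Set.indicator_of_mem (by exact h), Pi.one_apply, one_mul, density]
      refine Finset.prod_congr rfl fun j _ => ?_
      split_ifs with hj
      · rw [Set.indicator_of_mem (by exact h j hj)]
      · rfl
    · rw [Set.indicator_of_notMem (by exact h), zero_mul]
      push Not at h
      obtain ⟨j, hj, hlt⟩ := h
      refine (Finset.prod_eq_zero (Finset.mem_univ j) ?_).symm
      rw [if_pos hj, Set.indicator_of_notMem (by simpa using hlt)]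
  simp only [h1]
  rw [integral_fintype_prod_eq_prod, ← Finset.prod_subset (Finset.subset_univ u)]
  · refine Finset.prod_congr rfl fun j hj => ?_
    rw [if_pos hj, setIntegral_indicator measurableSet_Iic, cdf,
      intervalIntegral.integral_of_le (hz.1 j), ← integral_Icc_eq_integral_Ioc]
    congr 2
    ext t
    have := hz.2 j
    simp only [Set.mem_Icc, Set.mem_inter_iff, Set.mem_Iic]
    exact ⟨fun h => ⟨h.1.1, h.2⟩, fun h => ⟨⟨h.1, h.2.trans this⟩, h.2⟩⟩
  · intro j _ hj
    rw [if_neg hj]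
    exact M.φ_integral j (k j)

lemma integral_density : ∫ x in Set.Icc a b, M.density k x = 1 := by
  rw [restrict_box_eq_pi]
  unfold density
  rw [integral_fintype_prod_eq_prod]
  exact Finset.prod_eq_one fun j _ => M.φ_integral j (k j)

lemma invCdfMap_mem_and_le_iff {y : Fin s → ℝ} (hy : ∀ j, y j ∈ Set.Icc (0 : ℝ) 1) :
    M.invCdfMap k y ∈ Set.Icc a b ∧ ∀ z ∈ Set.Icc a b, ∀ j,
      (M.invCdfMap k y j ≤ z j ↔ y j ≤ cdf (a j) (M.φ j (k j)) (z j)) := by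
  have h := fun j => invCdf_mem_and_le_iff (M.φ_nonneg j (k j)) (M.φ_integrable j (k j))
    (M.cdf_bijOn j (k j)) (hy j)
  exact ⟨⟨fun j => (h j).1.1, fun j => (h j).1.2⟩, fun z hz j => (h j).2 (z j) ⟨hz.1 j, hz.2 j⟩⟩

section error

variable {f : (Fin s → ℝ) → ℝ} {S : Finset (Fin s) → ℝ}

lemma integrableOn_mul_density (hab : ∀ j, a j < b j) (hf : HasMixedPartials a b f)
    (hbd : ∀ u x, |extendedPartial a b f u x| ≤ S u) :
    IntegrableOn (fun x => f x * M.density k x) (Set.Icc a b) := by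
  have h : IntegrableOn (fun x => extendedPartial a b f ∅ x * M.density k x) (Set.Icc a b) :=
    (M.integrableOn_density k).bdd_mul (c := S ∅)
      (measurable_extendedPartial hab hf hbd ∅).aestronglyMeasurable
      (Filter.Eventually.of_forall (hbd ∅))
  refine h.congr_fun (fun x hx => ?_) measurableSet_Icc
  simp only [extendedPartial, mixedPartial_empty, clampBox_of_mem hx]

/-- The trivial error bound for components that are dropped or receive no points, where the estimate
is `0`. -/
lemma abs_integral_mul_density_le (hab : ∀ j, a j < b j) (hf : HasMixedPartials a b f)
    (hbd : ∀ u x, |extendedPartial a b f u x| ≤ S u) :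
    |∫ x in Set.Icc a b, f x * M.density k x| ≤ S ∅ := by
  calc _ ≤ ∫ x in Set.Icc a b, S ∅ * M.density k x := by
        refine (abs_integral_le_integral_abs).trans ?_
        refine setIntegral_mono_on (M.integrableOn_mul_density k hab hf hbd).abs
          ((M.integrableOn_density k).const_mul _) measurableSet_Icc fun x hx => ?_
        rw [abs_mul, abs_of_nonneg (M.density_nonneg k hx)]
        have h := hbd ∅ x
        simp only [extendedPartial, mixedPartial_empty, clampBox_of_mem hx] at h
        exact mul_le_mul_of_nonneg_right h (M.density_nonneg k hx)
    _ = S ∅ := by rw [integral_const_mul, integral_density, mul_one]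

/-- Error bound for the first `n ≤ N` points of a digital sequence, transported to the
component `k`. -/
theorem abs_integral_sub_average_le (hab : ∀ j, a j < b j) (hf : HasMixedPartials a b f)
    (hbd : ∀ u x, |extendedPartial a b f u x| ≤ S u) {t : ℕ} {C : Fin s → Matrix ℕ ℕ (ZMod 2)}
    (hC : GeneratesDigitalSequence t C) {n N : ℕ} (hn : 0 < n) (hnN : n ≤ N) (hN : 2 ≤ N) :
    |(∫ x in Set.Icc a b, f x * M.density k x)
        - 1 / n * ∑ i ∈ Finset.range n, f (M.invCdfMap k (digitalSequence C i))|
      ≤ (5 * 2 ^ t * Real.log (2 * N) * ∑ u ∈ Finset.univ.erase ∅,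
          S u * ∏ j ∈ u, (3 * (b j - a j) * Real.log N)) / n := by
  classical
  let X : ℕ → Fin s → ℝ := fun i => M.invCdfMap k (digitalSequence C i)
  have hX := fun i => M.invCdfMap_mem_and_le_iff k (digitalSequence_mem_Icc hC.1 i)
  have hmeas := measurable_extendedPartial hab hf hbd
  have hfin : IsFiniteMeasure (empiricalMeasure X n) := isFiniteMeasure_empiricalMeasure X hn
  have hn0 : (0 : ℝ) < n := by exact_mod_cast hn
  -- Both measures have mass one, so `u = ∅` contributes nothing. This is why the bound, like `G`,
  -- runs over nonempty `u` only.
  let D : Finset (Fin s) → ℝ := fun u => if u = ∅ then 0 else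
    5 * 2 ^ t * Real.log (2 * N) * (3 * Real.log N) ^ u.card / n
  have hmain := abs_integral_sub_le hab hmeas hbd
    (fun u j hj x hx => extendedPartial_eq_sub_integral hab hf hbd u j hj x hx)
    (M.componentMeasure k) (empiricalMeasure X n) (M.ae_componentMeasure k)
    (ae_empiricalMeasure X measurableSet_Icc fun i => (hX i).1) D ?_
  · rw [integral_empiricalMeasure X (hmeas ∅), integral_componentMeasure] at hmain
    have e1 : ∫ x in Set.Icc a b, extendedPartial a b f ∅ x * M.density k x
        = ∫ x in Set.Icc a b, f x * M.density k x :=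
      setIntegral_congr_fun measurableSet_Icc fun x hx => by
        simp only [extendedPartial, mixedPartial_empty, clampBox_of_mem hx]
    have e2 : ∀ i, extendedPartial a b f ∅ (X i) = f (X i) := fun i => by
      rw [extendedPartial, mixedPartial_empty, clampBox_of_mem (hX i).1]
    rw [e1, Finset.sum_congr rfl fun i _ => e2 i] at hmain
    refine hmain.trans (le_of_eq ?_)
    rw [← Finset.add_sum_erase _ _ (Finset.mem_univ ∅), Finset.mul_sum, Finset.sum_div]
    simp only [D, if_true, mul_zero, zero_add]
    refine Finset.sum_congr rfl fun u hu => ?_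
    rw [if_neg (Finset.ne_of_mem_erase hu)]
    have : ∏ j ∈ u, (3 * (b j - a j) * Real.log N)
        = (∏ j ∈ u, (b j - a j)) * (3 * Real.log N) ^ u.card := by
      rw [← Finset.prod_const, ← Finset.prod_mul_distrib]
      exact Finset.prod_congr rfl fun j _ => by ring
    rw [this]
    ring
  · intro u z hz
    rw [M.measureReal_componentMeasure_box k u hz,
      measureReal_empiricalMeasure X (measurableSet_forall_le u z)]
    by_cases hu : u = ∅
    · subst hu
      simp [D, hn.ne']
    · simp only [D, if_neg hu]
      have h := abs_card_box_sub_le hC u (fun j => cdf (a j) (M.φ j (k j)) (z j))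
        (fun j => (M.cdf_bijOn j (k j)).mapsTo ⟨hz.1 j, hz.2 j⟩) hnN hN
      have hset : (Finset.range n).filter (fun i => X i ∈ {x : Fin s → ℝ | ∀ i ∈ u, x i ≤ z i})
          = (Finset.range n).filter
            (fun i => ∀ j ∈ u, digitalSequence C i j ≤ cdf (a j) (M.φ j (k j)) (z j)) := by
        refine Finset.filter_congr fun i _ => ?_
        exact forall₂_congr fun j _ => (hX i).2 z hz j
      rw [hset, le_div_iff₀ hn0, abs_sub_comm]
      refine le_trans (le_of_eq ?_) h
      nth_rewrite 2 [← abs_of_pos hn0]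
      rw [← abs_mul]
      congr 1
      field_simp

end error

end Mixture

end MixtureQMC

namespace MixtureQMC

/-! ### Weighted norms -/

section lpSum

variable {ι : Type*} {T T' : Finset ι} {p q : ℝ≥0∞} {v w : ι → ℝ≥0∞}

lemma lpSum_mono_set (hTT' : T ⊆ T') : lpSum T p v ≤ lpSum T' p v := by
  unfold lpSum
  split_ifs with h
  · exact Finset.sup_mono hTT'
  · exact ENNReal.rpow_le_rpow (Finset.sum_le_sum_of_subset hTT') (by positivity)

lemma le_lpSum (hp : 1 ≤ p) {i : ι} (hi : i ∈ T) : v i ≤ lpSum T p v := by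
  unfold lpSum
  split_ifs with h
  · exact Finset.le_sup hi
  · have hp0 : 0 < p.toReal := ENNReal.toReal_pos (zero_lt_one.trans_le hp).ne' h
    calc v i = (v i ^ p.toReal) ^ (1 / p.toReal) := by
          rw [← ENNReal.rpow_mul, mul_one_div_cancel hp0.ne', ENNReal.rpow_one]
      _ ≤ _ := ENNReal.rpow_le_rpow
          (Finset.single_le_sum (f := fun i => v i ^ p.toReal) (fun _ _ => zero_le) hi)
          (by positivity)

lemma lpSum_lt_top (hv : ∀ i ∈ T, v i < ∞) : lpSum T p v < ∞ := by
  unfold lpSum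
  split_ifs with h
  · exact (Finset.sup_lt_iff (by simp)).2 hv
  · refine ENNReal.rpow_lt_top_of_nonneg (by positivity) (ENNReal.sum_lt_top.2 fun i hi => ?_).ne
    exact ENNReal.rpow_lt_top_of_nonneg (by positivity) (hv i hi).ne

lemma lpSum_one : lpSum T 1 v = ∑ i ∈ T, v i := by
  simp [lpSum]

lemma sum_mul_le_lpSum_one_mul_lpSum_top :
    ∑ i ∈ T, v i * w i ≤ lpSum T 1 v * lpSum T ∞ w := by
  rw [lpSum_one, lpSum, if_pos rfl, Finset.sum_mul]
  exact Finset.sum_le_sum fun i hi => mul_le_mul_right (Finset.le_sup hi) _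

/-- Hölder's inequality for finite sums, including the endpoints. -/
lemma sum_mul_le_lpSum_mul_lpSum (hpq : 1 / p + 1 / q = 1) :
    ∑ i ∈ T, v i * w i ≤ lpSum T p v * lpSum T q w := by
  by_cases hp : p = ∞
  · have hq : q = 1 := by simpa [hp] using hpq
    rw [hp, hq, mul_comm, Finset.sum_congr rfl fun i _ => mul_comm (v i) (w i)]
    exact sum_mul_le_lpSum_one_mul_lpSum_top
  by_cases hq : q = ∞
  · have hp : p = 1 := by simpa [hq] using hpq
    rw [hp, hq]
    exact sum_mul_le_lpSum_one_mul_lpSum_top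
  have : ENNReal.HolderConjugate p q := ⟨by simpa using hpq⟩
  have h := ENNReal.inner_le_Lp_mul_Lq T v w (ENNReal.HolderConjugate.toReal_of_ne_top hp hq)
  simpa only [lpSum, if_neg hp, if_neg hq] using h

end lpSum

section weightedNorm

variable {s : ℕ} {a b : Fin s → ℝ} {γ : Finset (Fin s) → ℝ} {p q : ℝ≥0∞}
  {f : (Fin s → ℝ) → ℝ}

/-- The supremum on the box of a mixed partial derivative. -/
noncomputable def partialSup (a b : Fin s → ℝ) (f : (Fin s → ℝ) → ℝ) (u : Finset (Fin s)) : ℝ :=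
  (⨆ x ∈ Set.Icc a b, ‖mixedPartial a b u f x‖ₑ).toReal

/-- Positive weights make each supremum finite. Without this, `toReal` would turn an infinite
supremum into `0` and `partialSup` would bound nothing. -/
lemma iSup_enorm_mixedPartial_lt_top (hγ : ∀ u, 0 < γ u) (hp : 1 ≤ p)
    (hf : weightedNorm a b γ p f < ∞) (u : Finset (Fin s)) :
    ⨆ x ∈ Set.Icc a b, ‖mixedPartial a b u f x‖ₑ < ∞ := by
  have h := (le_lpSum (v := fun u => ENNReal.ofReal (1 / γ u)
    * ⨆ x ∈ Set.Icc a b, ‖mixedPartial a b u f x‖ₑ) hp (Finset.mem_univ u)).trans_lt hf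
  refine lt_of_le_of_ne le_top fun htop => ?_
  simp only [htop] at h
  rw [ENNReal.mul_top (by simpa using hγ u)] at h
  exact lt_irrefl _ h

lemma abs_extendedPartial_le_partialSup (hab : ∀ j, a j < b j) (hγ : ∀ u, 0 < γ u) (hp : 1 ≤ p)
    (hf : weightedNorm a b γ p f < ∞) (u : Finset (Fin s)) (x : Fin s → ℝ) :
    |extendedPartial a b f u x| ≤ partialSup a b f u := by
  have h : ‖mixedPartial a b u f (clampBox a b x)‖ₑ
      ≤ ⨆ x ∈ Set.Icc a b, ‖mixedPartial a b u f x‖ₑ :=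
    le_iSup₂ (f := fun x (_ : x ∈ Set.Icc a b) => ‖mixedPartial a b u f x‖ₑ) _
      (clampBox_mem hab x)
  have := ENNReal.toReal_mono (iSup_enorm_mixedPartial_lt_top hγ hp hf u).ne h
  rwa [toReal_enorm, Real.norm_eq_abs] at this

lemma partialSup_empty_le (hγ : ∀ u, 0 < γ u) (hγ_empty : γ ∅ ≤ 1) (hp : 1 ≤ p)
    (hf : weightedNorm a b γ p f < ∞) :
    partialSup a b f ∅ ≤ (weightedNorm a b γ p f).toReal := by
  refine ENNReal.toReal_mono hf.ne ?_
  refine le_trans ?_ (le_lpSum hp (Finset.mem_univ ∅))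
  refine le_mul_of_one_le_left' ?_
  rw [ENNReal.one_le_ofReal]
  exact (one_le_div (hγ ∅)).2 hγ_empty

/-- Hölder's inequality between the weighted norm and `G`. -/
lemma sum_partialSup_mul_le (hab : ∀ j, a j < b j) (hγ : ∀ u, 0 < γ u)
    (hp : 1 ≤ p) (hpq : 1 / p + 1 / q = 1) (hf : weightedNorm a b γ p f < ∞) (N : ℕ) :
    ∑ u ∈ Finset.univ.erase ∅, partialSup a b f u * ∏ j ∈ u, (3 * (b j - a j) * Real.log N)
      ≤ (weightedNorm a b γ p f).toReal * G γ q a b N := by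
  have hprod : ∀ u : Finset (Fin s), 0 ≤ ∏ j ∈ u, (3 * (b j - a j) * Real.log N) := fun u =>
    Finset.prod_nonneg fun j _ => mul_nonneg (by linarith [hab j]) (Real.log_natCast_nonneg N)
  have hG : lpSum (Finset.univ.erase ∅) q
      (fun u => ENNReal.ofReal (γ u * ∏ j ∈ u, (3 * (b j - a j) * Real.log N))) < ∞ :=
    lpSum_lt_top fun _ _ => ENNReal.ofReal_lt_top
  rw [G, ← ENNReal.toReal_mul]
  have hS0 : ∀ u, 0 ≤ partialSup a b f u := fun u => ENNReal.toReal_nonneg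
  refine (ENNReal.ofReal_le_iff_le_toReal (ENNReal.mul_lt_top hf hG).ne).1 ?_
  rw [ENNReal.ofReal_sum_of_nonneg fun u _ => mul_nonneg (hS0 u) (hprod u)]
  refine le_trans (le_of_eq ?_) ((sum_mul_le_lpSum_mul_lpSum hpq).trans
    (mul_le_mul_left (lpSum_mono_set (Finset.erase_subset _ _)) _))
  refine Finset.sum_congr rfl fun u _ => ?_
  rw [← ENNReal.ofReal_toReal (iSup_enorm_mixedPartial_lt_top hγ hp hf u).ne,
    ← ENNReal.ofReal_mul (one_div_pos.2 (hγ u)).le]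
  change _ = ENNReal.ofReal (1 / γ u * partialSup a b f u) * _
  rw [← ENNReal.ofReal_mul (mul_nonneg (one_div_pos.2 (hγ u)).le (hS0 u))]
  -- The weights `1 / γ u` and `γ u` cancel.
  congr 1
  have := (hγ u).ne'
  generalize ∏ j ∈ u, (3 * (b j - a j) * Real.log N) = Q
  field_simp

end weightedNorm

/-! ### The allocation of the points to the mixture components -/

namespace Mixture

variable {s : ℕ} {a b : Fin s → ℝ} {M : Mixture a b} (e : M.Ordering) {N : ℕ} {δ : ℝ}

/-- The normalized coefficient of the component with number `v`. -/
noncomputable def Ordering.weight (v : Fin (Fintype.card M.Index)) : ℝ :=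
  M.c (e.toEquiv v) / M.total

lemma total_pos : 0 < M.total := M.c_sum_pos

lemma Ordering.weight_nonneg (v : Fin (Fintype.card M.Index)) : 0 ≤ e.weight v :=
  div_nonneg (M.c_nonneg _) total_pos.le

lemma Ordering.sum_weight : ∑ v, e.weight v = 1 := by
  unfold Ordering.weight
  rw [← Finset.sum_div, Equiv.sum_comp e.toEquiv M.c]
  exact div_self total_pos.ne'

/-- Keeping all components is admissible, so the infimum defining `r` is attained and is not the
default value of an empty set. -/
lemma Ordering.card_mem (hN : 0 < N) (hδ : 0 < δ) :
    1 - δ / N ≤ ∑ v with (v : Fin (Fintype.card M.Index)).val < Fintype.card M.Index,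
      M.c (e.toEquiv v) / M.total := by
  rw [Finset.filter_true_of_mem fun v _ => v.2]
  change _ ≤ ∑ v, e.weight v
  rw [e.sum_weight]
  have : 0 < δ / N := by positivity
  linarith

lemma Ordering.r_le_card (hN : 0 < N) (hδ : 0 < δ) : e.r N δ ≤ Fintype.card M.Index :=
  Nat.sInf_le (e.card_mem hN hδ)

lemma Ordering.le_sum_weight (hN : 0 < N) (hδ : 0 < δ) :
    1 - δ / N ≤ ∑ v with (v : Fin (Fintype.card M.Index)).val < e.r N δ, e.weight v :=
  Nat.sInf_mem (s := {r : ℕ | 1 - δ / N ≤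
    ∑ v with (v : Fin (Fintype.card M.Index)).val < r, M.c (e.toEquiv v) / M.total})
    ⟨_, e.card_mem hN hδ⟩

lemma Ordering.r_pos (hN : 0 < N) (hδ : 0 < δ) (hδN : δ < N) : 0 < e.r N δ := by
  by_contra h
  have h0 : e.r N δ = 0 := by omega
  have := e.le_sum_weight hN hδ
  simp only [h0, not_lt_zero, Finset.filter_false, Finset.sum_empty] at this
  have h1 : δ / N < 1 := (div_lt_one (by exact_mod_cast hN)).2 hδN
  linarith

lemma Ordering.size_of_ne {v : Fin (Fintype.card M.Index)} (hv : v.val + 1 ≠ e.r N δ) :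
    e.size N δ v = ⌊N * e.weight v⌋₊ := by
  rw [Ordering.size, if_neg hv, Ordering.weight, mul_div_assoc]

lemma Ordering.weight_mul_lt_size_add_one {v : Fin (Fintype.card M.Index)}
    (hv : v.val + 1 ≠ e.r N δ) : N * e.weight v < e.size N δ v + 1 := by
  rw [e.size_of_ne hv]
  exact Nat.lt_floor_add_one _

/-- Rounding down gives the earlier components at most `N` times their weight, and all weights sum
to `1`, so at least `N w_v` points are left. The natural subtraction can only err upwards, which is
harmless here. -/
lemma Ordering.weight_mul_le_size {v : Fin (Fintype.card M.Index)}
    (hv : v.val + 1 = e.r N δ) : N * e.weight v ≤ e.size N δ v := by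
  rw [Ordering.size, if_pos hv]
  set X := ∑ w with (w : Fin (Fintype.card M.Index)).val + 1 < e.r N δ,
      ⌊N * M.c (e.toEquiv w) / M.total⌋₊ with hX
  have h1 : (X : ℝ) ≤ N * ∑ w with (w : Fin (Fintype.card M.Index)).val + 1 < e.r N δ,
      e.weight w := by
    rw [hX, Nat.cast_sum, Finset.mul_sum]
    refine Finset.sum_le_sum fun w _ => ?_
    rw [mul_div_assoc]
    exact Nat.floor_le (mul_nonneg (Nat.cast_nonneg _) (e.weight_nonneg w))
  have h2 : ∑ w with (w : Fin (Fintype.card M.Index)).val + 1 < e.r N δ, e.weight w + e.weight v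
      ≤ 1 := by
    rw [← e.sum_weight, add_comm, ← Finset.sum_insert (by simp [hv])]
    exact Finset.sum_le_sum_of_subset_of_nonneg (Finset.subset_univ _)
      fun w _ _ => e.weight_nonneg w
  have h3 : (N : ℝ) ≤ ((N - X : ℕ) : ℝ) + X := by
    have : N ≤ N - X + X := by omega
    exact_mod_cast this
  have h4 := mul_le_mul_of_nonneg_left h2 (Nat.cast_nonneg (α := ℝ) N)
  linarith

lemma Ordering.size_le (v : Fin (Fintype.card M.Index)) : e.size N δ v ≤ N := by
  by_cases hv : v.val + 1 = e.r N δ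
  · rw [Ordering.size, if_pos hv]
    exact Nat.sub_le _ _
  · rw [e.size_of_ne hv]
    refine Nat.floor_le_of_le (mul_le_of_le_one_right (Nat.cast_nonneg _) ?_)
    rw [← e.sum_weight]
    exact Finset.single_le_sum (fun w _ => e.weight_nonneg w) (Finset.mem_univ v)

/-- If the components have error at most `A`, and at most `H / n` when `n > 0` points are given to
them, then the total weighted error is at most `(δ + 3 r - 2) / N * (A + H)`. -/
lemma Ordering.sum_weight_mul_le (hN : 0 < N) (hδ : 0 < δ) (hδN : δ < N) {A H : ℝ} (hA : 0 ≤ A)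
    (hH : 0 ≤ H) (err : Fin (Fintype.card M.Index) → ℝ)
    (h0 : ∀ v, e.r N δ ≤ v.val ∨ e.size N δ v = 0 → err v ≤ A)
    (h1 : ∀ v, v.val < e.r N δ → 0 < e.size N δ v → err v ≤ H / e.size N δ v) :
    ∑ v, e.weight v * err v ≤ (δ + 3 * e.r N δ - 2) / N * (A + H) := by
  have hN0 : (0 : ℝ) < N := by exact_mod_cast hN
  have hr := e.r_pos hN hδ hδN
  have hkept : ∀ v : Fin (Fintype.card M.Index), v.val < e.r N δ →
      e.weight v * err v
        ≤ (if v.val + 1 = e.r N δ then 1 else 3) * ((A + H) / N) := by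
    intro v hv
    have hw := e.weight_nonneg v
    rw [mul_div_assoc', le_div_iff₀ hN0]
    rcases Nat.eq_zero_or_pos (e.size N δ v) with hsz | hsz
    · have hE := h0 v (Or.inr hsz)
      have hwE : e.weight v * err v * N ≤ N * e.weight v * A := by
        have := mul_le_mul_of_nonneg_left hE (mul_nonneg hN0.le hw)
        linarith
      split_ifs with hvr
      · have h := e.weight_mul_le_size hvr
        rw [hsz, Nat.cast_zero] at h
        nlinarith
      · have h := e.weight_mul_lt_size_add_one hvr
        rw [hsz, Nat.cast_zero, zero_add] at h
        nlinarith
    · have hE := h1 v hv hsz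
      have hsz1 : (1 : ℝ) ≤ e.size N δ v := by exact_mod_cast hsz
      have hsz0 : (0 : ℝ) < e.size N δ v := by linarith
      have hwE : e.weight v * err v * N ≤ N * e.weight v / e.size N δ v * H := by
        have := mul_le_mul_of_nonneg_left hE (mul_nonneg hN0.le hw)
        calc _ = N * e.weight v * err v := by ring
          _ ≤ _ := this
          _ = _ := by ring
      split_ifs with hvr
      · have h := e.weight_mul_le_size hvr
        have : N * e.weight v / e.size N δ v ≤ 1 := (div_le_one hsz0).2 h
        nlinarith
      · have h := e.weight_mul_lt_size_add_one hvr
        -- From `N w_v < n_v + 1` and `1 ≤ n_v`.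
        have : N * e.weight v / e.size N δ v ≤ 3 := by
          rw [div_le_iff₀ hsz0]
          linarith
        nlinarith
  have hsplit := Finset.sum_filter_add_sum_filter_not Finset.univ
    (fun v : Fin (Fintype.card M.Index) => v.val < e.r N δ) (fun v => e.weight v * err v)
  have hsplitw := Finset.sum_filter_add_sum_filter_not Finset.univ
    (fun v : Fin (Fintype.card M.Index) => v.val < e.r N δ) (fun v => e.weight v)
  rw [e.sum_weight] at hsplitw
  have hmass := e.le_sum_weight (M := M) hN hδ
  have htail : ∑ v with ¬ (v : Fin (Fintype.card M.Index)).val < e.r N δ, e.weight v * err v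
      ≤ δ / N * A := by
    calc _ ≤ ∑ v with ¬ (v : Fin (Fintype.card M.Index)).val < e.r N δ, e.weight v * A := by
          refine Finset.sum_le_sum fun v hv => ?_
          exact mul_le_mul_of_nonneg_left (h0 v (Or.inl (not_lt.1 (Finset.mem_filter.1 hv).2)))
            (e.weight_nonneg v)
      _ = (∑ v with ¬ (v : Fin (Fintype.card M.Index)).val < e.r N δ, e.weight v) * A := by
          rw [Finset.sum_mul]
      _ ≤ _ := mul_le_mul_of_nonneg_right (by linarith) hA
  have hcard := e.r_le_card (M := M) hN hδ
  have hcount : ∑ v with (v : Fin (Fintype.card M.Index)).val < e.r N δ,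
      (if v.val + 1 = e.r N δ then (1 : ℝ) else 3) = 3 * e.r N δ - 2 := by
    -- Index `r - 1` is the last kept component, since numbering starts at `0`. Its constant `1 = 3
    -- - 2` accounts for the `- 2` in `3 r - 2`.
    have hval : ∀ v : Fin (Fintype.card M.Index), (if v.val + 1 = e.r N δ then (1 : ℝ) else 3)
        = 3 - (if v = ⟨e.r N δ - 1, by omega⟩ then 2 else 0) := by
      intro v
      have : v.val + 1 = e.r N δ ↔ v = ⟨e.r N δ - 1, by omega⟩ := by
        rw [Fin.ext_iff]; simp only; omega
      simp only [this]
      split_ifs <;> norm_num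
    rw [Finset.sum_congr rfl fun v _ => hval v, Finset.sum_sub_distrib, Finset.sum_const,
      Fin.card_filter_val_lt, min_eq_right hcard, Finset.sum_ite_eq', if_pos (by simp; omega),
      nsmul_eq_mul, mul_comm]
  have hhead : ∑ v with (v : Fin (Fintype.card M.Index)).val < e.r N δ, e.weight v * err v
      ≤ (3 * e.r N δ - 2) * ((A + H) / N) := by
    rw [← hcount, Finset.sum_mul]
    exact Finset.sum_le_sum fun v hv => hkept v (Finset.mem_filter.1 hv).2
  have hδA : δ / N * A ≤ δ / N * (A + H) :=
    mul_le_mul_of_nonneg_left (by linarith) (by positivity)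
  calc _ ≤ (3 * e.r N δ - 2) * ((A + H) / N) + δ / N * (A + H) := by linarith
    _ = _ := by ring

end Mixture

end MixtureQMC

namespace MixtureQMC

open MeasureTheory

namespace Mixture

variable {s : ℕ} {a b : Fin s → ℝ} {M : Mixture a b} (e : M.Ordering) {N : ℕ} {δ : ℝ}
  {f : (Fin s → ℝ) → ℝ}

/-! ### Assembly of the error bound -/

lemma mul_normalizedDensity_eq (x : Fin s → ℝ) :
    f x * M.normalizedDensity x
      = ∑ v, e.weight v * (f x * M.density (e.toEquiv v) x) := by
  have h := Equiv.sum_comp e.toEquiv fun k => M.c k / M.total * (f x * M.density k x)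
  rw [normalizedDensity, Finset.sum_div, Finset.mul_sum]
  refine Eq.trans ?_ h.symm
  refine Finset.sum_congr rfl fun k _ => ?_
  rw [density]
  ring

/-- Dropped components are given the estimate `0`, so integral and algorithm can be compared term by
term over all components. -/
lemma algorithm_eq (y : ℕ → Fin s → ℝ) :
    e.algorithm N δ y f = ∑ v, e.weight v * (if v.val < e.r N δ then
      1 / e.size N δ v * ∑ i ∈ Finset.range (e.size N δ v), f (M.invCdfMap (e.toEquiv v) (y i))
      else 0) := by
  rw [Ordering.algorithm, Finset.mul_sum, Finset.sum_filter]
  refine Finset.sum_congr rfl fun v _ => ?_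
  rw [Ordering.weight]
  split_ifs
  · ring
  · simp

end Mixture

end MixtureQMC

theorem theorem1 {s : ℕ} (a b : Fin s → ℝ) (hab : ∀ j, a j < b j)
    (γ : Finset (Fin s) → ℝ) (hγ : ∀ u, 0 < γ u) (hγ_empty : γ ∅ ≤ 1)
    (p q : ℝ≥0∞) (hp : 1 ≤ p) (hq : 1 ≤ q) (hpq : 1 / p + 1 / q = 1)
    (M : MixtureQMC.Mixture a b) (e : M.Ordering)
    (N : ℕ) (hN : 2 ≤ N) (δ : ℝ) (hδ_pos : 0 < δ) (hδ_lt : δ < N)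
    (t : ℕ) (C : Fin s → Matrix ℕ ℕ (ZMod 2))
    (hC : MixtureQMC.GeneratesDigitalSequence t C)
    (hC_tri : ∀ j, MixtureQMC.IsNonsingularUpperTriangular (C j)) :
    e.r N δ ≤ ∏ j, (M.n j + 1) ∧
    ∀ f : (Fin s → ℝ) → ℝ, MixtureQMC.HasMixedPartials a b f →
      MixtureQMC.weightedNorm a b γ p f < ∞ →
      MeasureTheory.IntegrableOn (fun x => f x * M.normalizedDensity x) (Set.Icc a b) ∧
      |(∫ x in Set.Icc a b, f x * M.normalizedDensity x)
          - e.algorithm N δ (MixtureQMC.digitalSequence C) f|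
        ≤ (MixtureQMC.weightedNorm a b γ p f).toReal * ((δ + 3 * e.r N δ - 2) / N) *
          (1 + 5 * 2 ^ t * Real.log (2 * N) * MixtureQMC.G γ q a b N) := by
  have hN0 : 0 < N := by omega
  refine ⟨(e.r_le_card hN0 hδ_pos).trans (by simp), fun f hf hnorm => ?_⟩
  set S := MixtureQMC.partialSup a b f with hSdef
  have hbd := MixtureQMC.abs_extendedPartial_le_partialSup hab hγ hp hnorm
  have hS0 : ∀ u, 0 ≤ S u := fun u => ENNReal.toReal_nonneg
  have hint : ∀ k : M.Index, MeasureTheory.IntegrableOn (fun x => f x * M.density k x)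
      (Set.Icc a b) := fun k => M.integrableOn_mul_density k hab hf hbd
  simp only [MixtureQMC.Mixture.mul_normalizedDensity_eq e]
  refine ⟨MeasureTheory.integrable_finsetSum _ fun v _ => (hint _).const_mul _, ?_⟩
  rw [MeasureTheory.integral_finsetSum _ fun v _ => (hint _).const_mul _,
    MixtureQMC.Mixture.algorithm_eq, ← Finset.sum_sub_distrib]
  simp only [MeasureTheory.integral_const_mul, ← mul_sub]
  set K := 5 * 2 ^ t * Real.log (2 * N) with hK
  have hK0 : 0 ≤ K := by
    have : 0 ≤ Real.log (2 * N) := by exact_mod_cast Real.log_natCast_nonneg (2 * N)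
    positivity
  set H := ∑ u ∈ Finset.univ.erase ∅, S u * ∏ j ∈ u, (3 * (b j - a j) * Real.log N) with hH
  have hH0 : 0 ≤ H := Finset.sum_nonneg fun u _ => mul_nonneg (hS0 u) <|
    Finset.prod_nonneg fun j _ => mul_nonneg (by linarith [hab j]) (Real.log_natCast_nonneg N)
  -- Makes `δ + 3 r - 2` nonnegative, so that the bound on `A + H` may be multiplied by it.
  have hr : (1 : ℝ) ≤ e.r N δ := by exact_mod_cast e.r_pos hN0 hδ_pos hδ_lt
  refine (Finset.abs_sum_le_sum_abs _ _).trans ?_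
  simp only [abs_mul, abs_of_nonneg (e.weight_nonneg _)]
  refine (e.sum_weight_mul_le (A := S ∅) (H := K * H) hN0 hδ_pos hδ_lt (hS0 ∅)
    (mul_nonneg hK0 hH0) _ (fun v hv => ?_) (fun v hv hsz => ?_)).trans ?_
  · have h0 : (if v.val < e.r N δ then 1 / (e.size N δ v : ℝ) *
        ∑ i ∈ Finset.range (e.size N δ v),
          f (M.invCdfMap (e.toEquiv v) (MixtureQMC.digitalSequence C i)) else 0) = 0 := by
      rcases hv with hv | hv
      · rw [if_neg (not_lt.2 hv)]
      · simp [hv]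
    rw [h0, sub_zero]
    exact M.abs_integral_mul_density_le _ hab hf hbd
  · rw [if_pos hv]
    exact M.abs_integral_sub_average_le _ hab hf hbd hC hsz (e.size_le v) hN
  · have h1 := MixtureQMC.partialSup_empty_le hγ hγ_empty hp hnorm
    have h2 := MixtureQMC.sum_partialSup_mul_le hab hγ hp hpq hnorm N
    have h3 : S ∅ + K * H ≤ (MixtureQMC.weightedNorm a b γ p f).toReal
        * (1 + K * MixtureQMC.G γ q a b N) := by
      have := mul_le_mul_of_nonneg_left h2 hK0
      linarith
    calc _ ≤ (δ + 3 * e.r N δ - 2) / N * ((MixtureQMC.weightedNorm a b γ p f).toReal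
        * (1 + K * MixtureQMC.G γ q a b N)) :=
          mul_le_mul_of_nonneg_left h3 (div_nonneg (by linarith) (Nat.cast_nonneg N))
      _ = _ := by ring
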